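/- Let $m\ge 1$, $T>0$, $a_1,\dots,a_4\in\mathbb{N}$ with $a_i\ge 1$, $d_1,\dots,d_4>0$ and $L\in\mathbb{R}$. There is a constant $C\ge 0$, depending only on $m$, $T$, $L$, $a_1,\dots,a_4$ and $d_1,\dots,d_4$, such that the following holds for every $N$, every bounded open set $\Omega\subset\mathbb{R}^N$, all reaction constants $\nu_f,\nu_b\in\mathbb{R}$ (in particular positive ones) and all kernels $(k,l)\in\mathcal{PC}$ with $\|l\|_{L_1((0,T))}=L$. Here $(k,l)\in\mathcal{PC}$ means that $k\in L_{1,loc}([0,\infty))$ is nonnegative and nonincreasing, $l\in L_{1,loc}([0,\infty))$, and $k*l=1$ a.e. on $(0,\infty)$, where $(k*v)(t)=\int_0^t k(t-s)v(s)\,ds$. Put $\Omega_T=(0,T)\times\Omega$ and $r(c)=-\nu_f\,c_1^{a_1}c_2^{a_2}+\nu_b\,c_3^{a_3}c_4^{a_4}$. Let $c_i^0\in L_\infty(\Omega)$ with $c_i^0\ge 0$, and let $(c_1,\dots,c_4)$ with $c_i\ge 0$ a.e. in $\Omega_T$ be a solution of $$\partial_t\big(k*[c_i-c_i^0]\big)-d_i\,\Delta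 c_i^m=\sigma_i\,a_i\,r(c)\quad\text{in }\Omega_T,\qquad i=1,\dots,4,\qquad \sigma_1=\sigma_2=1,\ \sigma_3=\sigma_4=-1,$$ with homogeneous Neumann boundary conditions and initial values $c_i^0$. Solutions are understood in the following sense, which includes sufficiently smooth solutions on smooth bounded domains: $c_i\in L_2(\Omega_T)$, $r(c)\in L_2(\Omega_T)$, $c_i^m\in L_2((0,T);H^1_2(\Omega))$, and $$\int_0^T\!\!\int_\Omega\Big(-\eta_t\,\big(k*[c_i-c_i^0]\big)+d_i\nabla c_i^m\cdot\nabla\eta\Big)\,dx\,dt=\int_0^T\!\!\int_\Omega \sigma_i\,a_i\,r(c)\,\eta\,dx\,dt$$ for all $\eta\in H^1_2((0,T);L_2(\Omega))\cap L_2((0,T);H^1_2(\Omega))$ with $\eta|_{t=T}=0$. Then $$\sum_{i=1}^4\|c_i\|_{L_{m+1}(\Omega_T)}\le C\sum_{i=1}^4\|c_i^0\|_{L_{m+1}(\Omega)}.$$ -/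

import Mathlib

open MeasureTheory Set
open scoped ENNReal NNReal ContDiff

noncomputable section

namespace SubdiffusionReaction

/-- `(k, l) ∈ PC`: `k` is locally integrable on `[0, ∞)`, nonnegative and nonincreasing, and `l` is
locally integrable on `[0, ∞)` with `k * l = 1` (an identity in `L_{1,loc}`) on `(0, ∞)`. -/
structure IsPCPair (k l : ℝ → ℝ) : Prop where
  locInt_k : LocallyIntegrableOn k (Ici 0)
  nonneg : ∀ t, 0 < t → 0 ≤ k t
  antitone : AntitoneOn k (Ioi 0)
  locInt_l : LocallyIntegrableOn l (Ici 0)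
  conv_eq_one : ∀ᵐ t ∂(volume.restrict (Ioi (0 : ℝ))), ∫ s in Ioo 0 t, k (t - s) * l s = 1

/-- `ℝ^N` with the Euclidean norm. -/
abbrev Space (N : ℕ) : Type := EuclideanSpace ℝ (Fin N)

/-- The space-time cylinder `Ω_T = (0,T) × Ω`. -/
def cylinder {N : ℕ} (T : ℝ) (Ω : Set (Space N)) : Set (ℝ × Space N) := Ioo 0 T ×ˢ Ω

/-- Lebesgue measure on `Ω_T`. -/
def cylMeasure {N : ℕ} (T : ℝ) (Ω : Set (Space N)) : Measure (ℝ × Space N) :=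
  volume.restrict (cylinder T Ω)

/-- `(k * v)(t, x) = ∫_0^t k(t - s) v(s, x) ds`. -/
def timeConv {N : ℕ} (k : ℝ → ℝ) (v : ℝ × Space N → ℝ) (z : ℝ × Space N) : ℝ :=
  ∫ s in Ioo 0 z.1, k (z.1 - s) * v (s, z.2)

/-- `G` is the weak (distributional) gradient of `v` on the open set `Ω`. -/
structure IsWeakGradient {N : ℕ} (Ω : Set (Space N)) (v : Space N → ℝ)
    (G : Space N → Space N) : Prop where
  locInt : LocallyIntegrableOn v Ω
  locInt_grad : LocallyIntegrableOn G Ω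
  integral_eq : ∀ φ : Space N → ℝ, ContDiff ℝ ∞ φ → HasCompactSupport φ → tsupport φ ⊆ Ω →
    ∫ x in Ω, v x • gradient φ x = -∫ x in Ω, φ x • G x

/-- `w ∈ L_2((0,T); H^1_2(Ω))` with spatial weak gradient `G`. -/
structure IsL2H1 {N : ℕ} (T : ℝ) (Ω : Set (Space N)) (w : ℝ × Space N → ℝ)
    (G : ℝ × Space N → Space N) : Prop where
  memLp : MemLp w 2 (cylMeasure T Ω)
  memLp_grad : MemLp G 2 (cylMeasure T Ω)
  weakGradient : ∀ᵐ t ∂(volume.restrict (Ioo 0 T)),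
    IsWeakGradient Ω (fun x => w (t, x)) (fun x => G (t, x))

/-- `η ∈ H^1_2((0,T); L_2(Ω)) ∩ L_2((0,T); H^1_2(Ω))` with time derivative `η'`, spatial gradient
`G`, and `η|_{t=T} = 0`. The time derivative and the end condition are expressed by
`η(t) = - ∫_t^T η'(s) ds`. -/
structure IsTestFunction {N : ℕ} (T : ℝ) (Ω : Set (Space N)) (η η' : ℝ × Space N → ℝ)
    (G : ℝ × Space N → Space N) : Prop where
  l2h1 : IsL2H1 T Ω η G
  memLp_timeDeriv : MemLp η' 2 (cylMeasure T Ω)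
  eq_integral : ∀ᵐ z ∂(cylMeasure T Ω), η z = -∫ s in Ioo z.1 T, η' (s, z.2)

/-- Weak formulation of `∂_t (k * [u - u₀]) - Δ w = f` in `Ω_T`, with `∂_ν w = 0` on the lateral
boundary and `(k * [u - u₀])|_{t=0} = 0`. Here `G` is the spatial gradient of `w`; the Neumann
condition is encoded by test functions that need not vanish on the lateral boundary, the initial
condition by test functions that need not vanish at `t = 0`. -/
def IsWeakNeumannSolution {N : ℕ} (T : ℝ) (Ω : Set (Space N)) (k : ℝ → ℝ)
    (u : ℝ × Space N → ℝ) (u₀ : Space N → ℝ) (G : ℝ × Space N → Space N)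
    (f : ℝ × Space N → ℝ) : Prop :=
  ∀ (η η' : ℝ × Space N → ℝ) (H : ℝ × Space N → Space N), IsTestFunction T Ω η η' H →
    ∫ z, (-(η' z) * timeConv k (fun y => u y - u₀ y.2) z + inner ℝ (G z) (H z)) ∂(cylMeasure T Ω)
      = ∫ z, f z * η z ∂(cylMeasure T Ω)

/-- Mass action rate `r(c) = -ν_f c_1^{a_1} c_2^{a_2} + ν_b c_3^{a_3} c_4^{a_4}`
(indices shifted to `0, 1, 2, 3`). -/
def reactionRate (νf νb : ℝ) (a : Fin 4 → ℕ) (c : Fin 4 → ℝ) : ℝ :=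
  -νf * c 0 ^ a 0 * c 1 ^ a 1 + νb * c 2 ^ a 2 * c 3 ^ a 3

/-- Sign of the reaction term in the four equations. -/
def reactionSign : Fin 4 → ℝ := ![1, 1, -1, -1]

/-- `(c_1, …, c_4)` solves, with homogeneous Neumann conditions and initial values `c_i^0`,
`∂_t (k * [c_i - c_i^0]) - d_i Δ c_i^m = ± a_i r(c)` in `Ω_T`. The regularity is what gives each
term a meaning: `c_i, r(c) ∈ L_2(Ω_T)` and `c_i^m ∈ L_2((0,T); H^1_2(Ω))`. -/
structure IsSolution {N : ℕ} (T : ℝ) (Ω : Set (Space N)) (k : ℝ → ℝ) (m : ℝ)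
    (νf νb : ℝ) (a : Fin 4 → ℕ) (d : Fin 4 → ℝ)
    (c : Fin 4 → ℝ × Space N → ℝ) (c₀ : Fin 4 → Space N → ℝ) : Prop where
  memLp : ∀ i, MemLp (c i) 2 (cylMeasure T Ω)
  memLp_rate : MemLp (fun z => reactionRate νf νb a (fun j => c j z)) 2 (cylMeasure T Ω)
  equation : ∀ i, ∃ G : ℝ × Space N → Space N,
    IsL2H1 T Ω (fun z => c i z ^ m) G ∧
    IsWeakNeumannSolution T Ω k (c i) (c₀ i) (fun z => d i • G z)
      (fun z => reactionSign i * a i * reactionRate νf νb a (fun j => c j z))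

end SubdiffusionReaction

end

/-!
The proof is a duality argument. Put `u = ∑ c_i / a_i` and `w = ∑ (d_i / a_i) c_i^m`. In the sum of
the four equations with weights `1 / a_i` the reaction terms cancel, whatever their size, and
`∂_t (k * [u - u₀]) - Δ w = 0` remains. Testing it formally with `η = l ⋆ w`, where
`(l ⋆ w)(t) = ∫_t^T l(r - t) w(r) dr` is the adjoint of `w ↦ l * w`, and using `k * l = 1` gives
`∫ w (u - u₀) + ∫ ∇w · (l * ∇w) = 0`. The second term is nonnegative because `l` is of positive
type, so `∫ w u ≤ ∫ w u₀` (`IsSolution.duality_estimate`). As the `c_i` are nonnegative, the left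
side controls `∑ ∫ c_i^{m+1}`, and Young's inequality absorbs the factor `w` on the right.

The function `l ⋆ w` need not have a time derivative, so it is replaced by `η = l ⋆ S* S w` with the
Steklov average `(S w)(t) = h⁻¹ ∫_{t-h}^t w`, where `w` is extended by zero. Both `η` and `∂_t η` come
from `w` by integration in time against bounded kernels (`testKernel`, `testDerivKernel`), and such
operators preserve `L_2((0,T); H^1_2(Ω))` (`IsL2H1.kernelOp`), so `η` is admissible
(`isTestFunction_testKernel`). For almost every `x` the test is then a statement about functions on
`(0,T)`: the time derivative contributes `∫ S w S v` with `v = u - u₀`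
(`IsTruncatedPair.integral_testDeriv_mul`), which tends to `∫ w v` as `h → 0`
(`tendsto_integral_steklov_mul`), and the diffusion contributes `∫ S g (l * S g) ≥ 0` with
`g = ∇w` (`IsTruncatedPair.integral_mul_testKernel_nonneg`).

For the last inequality put `q = ∂_t (l * S g)`. Then `l * S g = 1 * q` and `S g = k * q`, so the claim
is `∫ (k * q) (1 * q) ≥ 0` (`integral_lineConv_antitone_nonneg`). Since `k` is nonnegative and
nonincreasing, it is a mixture of indicator functions of intervals starting at `0`, and for these
the inequality is elementary. The norm of `l` does not enter, and the constant depends on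
`m`, `T`, `a_i` and `d_i` only.
-/

noncomputable section

namespace SubdiffusionReaction

/-! ### Convolution of integrable functions on the line -/

/-- `(a * b)(t) = ∫ a(t - s) b(s) ds` on the whole line. Functions on `(0,T)` enter through their
extension by zero. -/
def lineConv (a b : ℝ → ℝ) (t : ℝ) : ℝ := ∫ s, a (t - s) * b s

/-- The backward difference quotient. -/
def diffQuot (h : ℝ) (b : ℝ → ℝ) (t : ℝ) : ℝ := h⁻¹ * (b t - b (t - h))

theorem lineConv_eq_convolution (a b : ℝ → ℝ) :
    lineConv a b = convolution a b (ContinuousLinearMap.mul ℝ ℝ) volume := by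
  ext t
  rw [convolution_mul_swap]
  rfl

theorem lineConv_comm (a b : ℝ → ℝ) : lineConv a b = lineConv b a := by
  ext t
  rw [lineConv_eq_convolution a b, convolution_mul]
  exact integral_congr_ae (Filter.Eventually.of_forall fun s => mul_comm _ _)

theorem integrable_lineConv_integrand {a b : ℝ → ℝ} (ha : Integrable a) (hb : Integrable b) :
    Integrable (fun p : ℝ × ℝ => a (p.1 - p.2) * b p.2) (volume.prod volume) := by
  simpa [mul_comm] using hb.convolution_integrand (ContinuousLinearMap.mul ℝ ℝ) ha

theorem integrable_lineConv {a b : ℝ → ℝ} (ha : Integrable a) (hb : Integrable b) :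
    Integrable (lineConv a b) :=
  (integrable_lineConv_integrand ha hb).integral_prod_left

theorem ae_integrable_lineConv {a b : ℝ → ℝ} (ha : Integrable a) (hb : Integrable b) :
    ∀ᵐ t, Integrable (fun s => a (t - s) * b s) :=
  (integrable_lineConv_integrand ha hb).prod_right_ae

theorem lineConv_assoc {a b c : ℝ → ℝ} (ha : Integrable a) (hb : Integrable b)
    (hc : Integrable c) :
    lineConv (lineConv a b) c =ᵐ[volume] lineConv a (lineConv b c) := by
  have h1 := ha.norm.ae_convolution_exists (ContinuousLinearMap.mul ℝ ℝ)
    (hb.norm.integrable_convolution (ContinuousLinearMap.mul ℝ ℝ) hc.norm)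
  filter_upwards [h1] with t ht
  simp only [lineConv_eq_convolution]
  exact convolution_assoc _ _ _ _ (fun x y z => mul_assoc x y z) ha.1 hb.1 hc.1
    (ha.ae_convolution_exists _ hb) (hb.norm.ae_convolution_exists _ hc.norm) ht

/-- The adjoint of `b ↦ a * b` is the backward correlation with `a`. -/
theorem integral_mul_lineConv {a b φ : ℝ → ℝ} (ha : Integrable a) (hb : Integrable b)
    (hφ : AEStronglyMeasurable φ) {C : ℝ} (hC : ∀ t, |φ t| ≤ C) :
    ∫ t, φ t * lineConv a b t = ∫ s, (∫ t, a (t - s) * φ t) * b s := by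
  have hint : Integrable (fun p : ℝ × ℝ => φ p.1 * (a (p.1 - p.2) * b p.2))
      (volume.prod volume) :=
    (integrable_lineConv_integrand ha hb).bdd_mul hφ.comp_fst
      (Filter.Eventually.of_forall fun p => hC p.1)
  calc ∫ t, φ t * lineConv a b t = ∫ t, ∫ s, φ t * (a (t - s) * b s) := by
        simp only [lineConv, integral_const_mul]
    _ = ∫ s, ∫ t, φ t * (a (t - s) * b s) := integral_integral_swap hint
    _ = _ := by
        refine integral_congr_ae (Filter.Eventually.of_forall fun s => ?_)
        simp only [← integral_mul_const]
        refine integral_congr_ae (Filter.Eventually.of_forall fun t => ?_)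
        simp only
        ring

/-- Causality: below time `T` the convolution only sees the values of the factors below `T`. -/
theorem lineConv_congr_left {a a' b : ℝ → ℝ} {T t : ℝ} (haa : ∀ᵐ r, r < T → a r = a' r)
    (hb : ∀ s ≤ 0, b s = 0) (ht : t ≤ T) : lineConv a b t = lineConv a' b t := by
  have h := (quasiMeasurePreserving_sub_left_of_right_invariant (volume : Measure ℝ) t).ae haa
  refine integral_congr_ae ?_
  filter_upwards [h] with s hs
  rcases le_or_gt s 0 with h0 | h0
  · simp [hb s h0]
  · rw [hs (by linarith)]

theorem lineConv_eq_zero {a b : ℝ → ℝ} (ha : ∀ s ≤ 0, a s = 0) (hb : ∀ s ≤ 0, b s = 0)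
    {t : ℝ} (ht : t ≤ 0) : lineConv a b t = 0 := by
  rw [lineConv, ← integral_zero ℝ ℝ (μ := volume)]
  refine integral_congr_ae (Filter.Eventually.of_forall fun s => ?_)
  rcases le_or_gt s 0 with h0 | h0
  · simp [hb s h0]
  · simp [ha (t - s) (by linarith)]

theorem integrable_diffQuot {b : ℝ → ℝ} (h : ℝ) (hb : Integrable b) :
    Integrable (diffQuot h b) :=
  (hb.sub (hb.comp_sub_right h)).const_mul _

theorem diffQuot_eq_zero {b : ℝ → ℝ} {h : ℝ} (hh : 0 < h) (hb : ∀ s ≤ 0, b s = 0) {t : ℝ}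
    (ht : t ≤ 0) : diffQuot h b t = 0 := by
  simp [diffQuot, hb t ht, hb (t - h) (by linarith)]

theorem lineConv_diffQuot {a b : ℝ → ℝ} (h : ℝ) (ha : Integrable a) (hb : Integrable b) :
    lineConv a (diffQuot h b) =ᵐ[volume] diffQuot h (lineConv a b) := by
  have h1 := ae_integrable_lineConv ha hb
  have h2 := (measurePreserving_sub_right (volume : Measure ℝ) h).quasiMeasurePreserving.ae h1
  filter_upwards [h1, h2] with t ht1 ht2
  have ht3 : Integrable (fun s => a (t - s) * b (s - h)) := by
    have := ht2.comp_sub_right h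
    refine this.congr (Filter.Eventually.of_forall fun s => ?_)
    simp only
    congr 2
    ring
  have e : lineConv a b (t - h) = ∫ s, a (t - s) * b (s - h) := by
    rw [lineConv, ← integral_sub_right_eq_self _ h]
    refine integral_congr_ae (Filter.Eventually.of_forall fun s => ?_)
    simp only
    congr 2
    ring
  rw [diffQuot, e, lineConv, lineConv, ← integral_sub ht1 ht3, ← integral_const_mul]
  refine integral_congr_ae (Filter.Eventually.of_forall fun s => ?_)
  simp only [diffQuot]
  ring

theorem diffQuot_lineConv_left {a b : ℝ → ℝ} (h : ℝ) (ha : Integrable a) (hb : Integrable b) :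
    lineConv (diffQuot h a) b =ᵐ[volume] diffQuot h (lineConv a b) := by
  rw [lineConv_comm, lineConv_comm a b]
  exact lineConv_diffQuot h hb ha

/-- Summation by parts: the adjoint of the backward difference quotient is minus the forward one. -/
theorem integral_forward_diff_mul {F V : ℝ → ℝ} (h : ℝ)
    (hFV : Integrable fun t => F t * V t) (hFV' : Integrable fun t => F (t + h) * V t) :
    ∫ t, h⁻¹ * (F t - F (t + h)) * V t = ∫ t, F t * diffQuot h V t := by
  have hs : Integrable fun t => F t * V (t - h) := by
    simpa using hFV'.comp_sub_right h
  have e : ∫ t, F (t + h) * V t = ∫ t, F t * V (t - h) := by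
    rw [← integral_sub_right_eq_self _ h]
    simp
  calc ∫ t, h⁻¹ * (F t - F (t + h)) * V t
      = ∫ t, h⁻¹ * (F t * V t - F (t + h) * V t) := by congr 1; ext t; ring
    _ = ∫ t, h⁻¹ * (F t * V t - F t * V (t - h)) := by
        rw [integral_const_mul, integral_const_mul, integral_sub hFV hFV', integral_sub hFV hs, e]
    _ = _ := by congr 1; ext t; simp only [diffQuot]; ring

/-! ### Kernels of positive type -/

/-- The indicator function of `(0,T)`, the kernel of integration in time. -/
def unitKernel (T : ℝ) : ℝ → ℝ := (Ioo 0 T).indicator fun _ => 1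

/-- The kernel `h⁻¹ 1_{(0,h]}` of the backward Steklov average. -/
def steklovKernel (h : ℝ) : ℝ → ℝ := (Ioc 0 h).indicator fun _ => h⁻¹

theorem measurable_unitKernel (T : ℝ) : Measurable (unitKernel T) :=
  measurable_const.indicator measurableSet_Ioo

theorem measurable_steklovKernel (h : ℝ) : Measurable (steklovKernel h) :=
  measurable_const.indicator measurableSet_Ioc

theorem integrable_unitKernel (T : ℝ) : Integrable (unitKernel T) :=
  (integrableOn_const (by simp)).integrable_indicator measurableSet_Ioo

theorem unitKernel_of_nonpos (T : ℝ) : ∀ s ≤ 0, unitKernel T s = 0 := fun s hs => by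
  simp [unitKernel, hs.not_gt]

theorem abs_steklovKernel_le {h : ℝ} (hh : 0 < h) (r : ℝ) : |steklovKernel h r| ≤ h⁻¹ := by
  have : 0 ≤ h⁻¹ := by positivity
  unfold steklovKernel indicator
  split_ifs <;> simp [this, abs_of_nonneg]

theorem diffQuot_unitKernel {T h r : ℝ} (hh : 0 < h) (hr : r < T) :
    diffQuot h (unitKernel T) r = steklovKernel h r := by
  simp only [diffQuot, unitKernel, steklovKernel, indicator, mem_Ioo, mem_Ioc]
  split_ifs <;> first | (exfalso; grind) | simp

theorem diffQuot_lineConv_unitKernel {T h : ℝ} (hh : 0 < h) {v : ℝ → ℝ} (hv : Integrable v)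
    (hv0 : ∀ s ≤ 0, v s = 0) :
    ∀ᵐ t, t < T → diffQuot h (lineConv (unitKernel T) v) t = lineConv (steklovKernel h) v t := by
  filter_upwards [diffQuot_lineConv_left h (integrable_unitKernel T) hv] with t ht htT
  rw [← ht]
  exact lineConv_congr_left (Filter.Eventually.of_forall fun r hr => diffQuot_unitKernel hh hr)
    hv0 htT.le

/-- For an initial interval `J` of `(0,∞)`, the kernel `1_J` has the positivity property of
`integral_lineConv_antitone_nonneg`: if `J` has length `a` and `φ` is the primitive of `q`, the integrand is
`φ(t) (φ(t) - φ(t - a)) ≥ (φ(t)² - φ(t - a)²) / 2`. -/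
theorem integral_primitive_mul_shift_nonneg {T a : ℝ} (ha : 0 ≤ a) {φ : ℝ → ℝ}
    (hφ : Continuous φ) (hφ0 : ∀ t ≤ 0, φ t = 0) :
    0 ≤ ∫ t in Ioo 0 T, φ t * (φ t - φ (t - a)) := by
  have hi : ∀ ψ : ℝ → ℝ, Continuous ψ → ∀ x y, IntegrableOn ψ (Ioo x y) := fun ψ hψ x y =>
    (hψ.integrableOn_Icc).mono_set Ioo_subset_Icc_self
  have e1 : ∫ t in Ioo 0 T, φ (t - a) ^ 2 ≤ ∫ t in Ioo 0 T, φ t ^ 2 := by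
    have : ∫ t in Ioo 0 T, φ (t - a) ^ 2 = ∫ t in Ioo (-a) (T - a), φ t ^ 2 := by
      rw [← integral_indicator measurableSet_Ioo, ← integral_indicator measurableSet_Ioo,
        ← integral_sub_right_eq_self ((Ioo (-a) (T - a)).indicator fun t => φ t ^ 2) a]
      congr 1
      ext t
      simp only [indicator, mem_Ioo]
      congr 1
      simp
    rw [this, ← integral_indicator measurableSet_Ioo, ← integral_indicator measurableSet_Ioo]
    refine integral_mono ((hi _ (hφ.pow 2) _ _).integrable_indicator measurableSet_Ioo)
      ((hi _ (hφ.pow 2) _ _).integrable_indicator measurableSet_Ioo) fun t => ?_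
    simp only [indicator, mem_Ioo]
    rcases le_or_gt t 0 with h | h
    · simp [hφ0 t h]
    · split_ifs with h1 h2
      · exact le_rfl
      · exact absurd ⟨h, by linarith [h1.2]⟩ h2
      · positivity
      · exact le_rfl
  have hc : Continuous fun t => φ (t - a) := by fun_prop
  calc (0 : ℝ) ≤ ∫ t in Ioo 0 T, (φ t ^ 2 / 2 - φ (t - a) ^ 2 / 2) := by
        rw [integral_sub (hi _ (by fun_prop) _ _) (hi _ (by fun_prop) _ _), integral_div,
          integral_div]
        linarith
    _ ≤ _ := by
        refine integral_mono (hi _ (by fun_prop) _ _) (hi _ (by fun_prop) _ _) fun t => ?_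
        simp only
        nlinarith [sq_nonneg (φ t - φ (t - a))]

theorem lineConv_unitKernel_eq_primitive {T : ℝ} {q : ℝ → ℝ}
    (hq0 : ∀ s ≤ 0, q s = 0) {t : ℝ} (ht : t ∈ Ioo 0 T) :
    lineConv (unitKernel T) q t = ∫ s in (0 : ℝ)..t, q s := by
  rw [intervalIntegral.integral_of_le ht.1.le, integral_Ioc_eq_integral_Ioo,
    ← integral_indicator measurableSet_Ioo]
  refine integral_congr_ae (Filter.Eventually.of_forall fun s => ?_)
  simp only [unitKernel, indicator, mem_Ioo]
  have h1 := ht.1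
  have h2 := ht.2
  split_ifs with h3 h4 h5
  · simp
  · rw [hq0 s (by grind)]; simp
  · grind
  · simp

/-- The superlevel sets of a kernel that is nonincreasing on `(0,T)` are initial intervals. -/
theorem exists_initial_interval {T lam : ℝ} {k : ℝ → ℝ} (hlam : 0 < lam)
    (hk0 : ∀ t, t ∉ Ioo 0 T → k t = 0) (hanti : AntitoneOn k (Ioo 0 T)) :
    ∃ a, 0 ≤ a ∧ Ioo 0 a ⊆ {r | lam < k r} ∧ {r | lam < k r} ⊆ Ioc 0 a := by
  have hsub : ∀ r, lam < k r → r ∈ Ioo 0 T := fun r hr => by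
    by_contra h
    rw [hk0 r h] at hr
    linarith
  by_cases hne : ∃ r, lam < k r
  · have hbdd : BddAbove {r | lam < k r} := ⟨T, fun r hr => (hsub r hr).2.le⟩
    obtain ⟨r₀, hr₀⟩ := hne
    refine ⟨sSup {r | lam < k r}, (hsub r₀ hr₀).1.le.trans (le_csSup hbdd hr₀), ?_, ?_⟩
    · intro r hr
      obtain ⟨s, hs, hrs⟩ := exists_lt_of_lt_csSup ⟨r₀, hr₀⟩ hr.2
      have hsT := hsub s hs
      exact lt_of_lt_of_le hs (hanti ⟨hr.1, hrs.trans hsT.2⟩ hsT hrs.le)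
    · exact fun r hr => ⟨(hsub r hr).1, le_csSup hbdd hr⟩
  · push Not at hne
    exact ⟨0, le_rfl, by simp, fun r hr => absurd hr (hne r).not_gt⟩

theorem integral_indicator_mul_eq_primitive_sub {J : Set ℝ} {a : ℝ} (ha : 0 ≤ a)
    (h1 : Ioo 0 a ⊆ J) (h2 : J ⊆ Ioc 0 a) {q : ℝ → ℝ} (hq : Integrable q) (t : ℝ) :
    ∫ s, J.indicator (fun _ => (1 : ℝ)) (t - s) * q s =
      (∫ s in (0 : ℝ)..t, q s) - ∫ s in (0 : ℝ)..(t - a), q s := by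
  rw [intervalIntegral.integral_interval_sub_left hq.intervalIntegrable hq.intervalIntegrable,
    intervalIntegral.integral_of_le (by linarith), ← integral_indicator measurableSet_Ioc]
  refine integral_congr_ae ?_
  have h3 : ∀ᵐ s : ℝ, s ≠ t - a := by simp [ae_iff]
  have h4 : ∀ᵐ s : ℝ, s ≠ t := by simp [ae_iff]
  filter_upwards [h3, h4] with s hs3 hs4
  have h5 : t - s ∈ J ↔ s ∈ Ioc (t - a) t := by
    constructor
    · intro h
      have := h2 h
      exact ⟨lt_of_le_of_ne (by linarith [this.2]) (Ne.symm hs3), by linarith [this.1]⟩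
    · intro h
      exact h1 ⟨by have := lt_of_le_of_ne h.2 hs4; linarith, by linarith [h.1]⟩
  by_cases h : s ∈ Ioc (t - a) t
  · rw [indicator_of_mem (h5.2 h), indicator_of_mem h, one_mul]
  · rw [indicator_of_notMem (fun h' => h (h5.1 h')), indicator_of_notMem h, zero_mul]

/-- A nonnegative nonincreasing kernel `k` is a mixture of the kernels `1_{{k > λ}}`, `λ > 0`, whose
supports are initial intervals. Hence `∫ (k * q)(1 * q) ≥ 0`: with `φ = 1 * q` this says that
`φ ↦ ∂_t (k * φ)` is accretive. -/
theorem integral_lineConv_antitone_nonneg {T : ℝ} {k q : ℝ → ℝ} (hkm : Measurable k)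
    (hk : Integrable k) (hk0 : ∀ t, t ∉ Ioo 0 T → k t = 0) (hkn : ∀ t, 0 ≤ k t)
    (hanti : AntitoneOn k (Ioo 0 T)) (hq : Integrable q) (hq0 : ∀ s ≤ 0, q s = 0) :
    0 ≤ ∫ t in Ioo 0 T, lineConv k q t * lineConv (unitKernel T) q t := by
  set φ : ℝ → ℝ := fun t => ∫ s in (0 : ℝ)..t, q s with hφ
  have hφc : Continuous φ :=
    intervalIntegral.continuous_primitive (fun _ _ => hq.intervalIntegrable) 0
  have hφ0 : ∀ t ≤ 0, φ t = 0 := fun t ht => by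
    rw [hφ]
    simp only
    rw [intervalIntegral.integral_symm, intervalIntegral.integral_of_le ht,
      setIntegral_eq_zero_of_forall_eq_zero fun s hs => hq0 s hs.2, neg_zero]
  set ψ : ℝ → ℝ := (Ioo 0 T).indicator φ with hψ
  have hψm : AEStronglyMeasurable ψ :=
    hφc.aestronglyMeasurable.indicator measurableSet_Ioo
  have hψb : ∀ t, ‖ψ t‖ ≤ ∫ s, ‖q s‖ := fun t => by
    refine (norm_indicator_le_norm_self _ _).trans ?_
    exact (intervalIntegral.norm_integral_le_integral_norm_uIoc).trans
      (setIntegral_le_integral hq.norm (Filter.Eventually.of_forall fun _ => norm_nonneg _))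
  -- The layer-cake integrand in the variables `((t, s), λ)`; its integral over `λ > 0` restores `k`.
  set Y : (ℝ × ℝ) × ℝ → ℝ := fun p =>
    ψ p.1.1 * (({r | p.2 < k r}.indicator (fun _ => (1 : ℝ)) (p.1.1 - p.1.2)) * q p.1.2) with hY
  have hset : ∀ p : ℝ × ℝ, ∀ lam, Y (p, lam) =
      (Iio (k (p.1 - p.2))).indicator (fun _ => ψ p.1 * q p.2) lam := fun p lam => by
    simp only [hY, indicator, mem_ofPred_eq, mem_Iio]
    split_ifs <;> simp
  have hYm : AEStronglyMeasurable Y ((volume.prod volume).prod (volume.restrict (Ioi 0))) := by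
    refine (hψm.comp_fst.comp_fst).mul (AEStronglyMeasurable.mul ?_ hq.1.comp_snd.comp_fst)
    have : MeasurableSet {p : (ℝ × ℝ) × ℝ | p.2 < k (p.1.1 - p.1.2)} :=
      measurableSet_lt measurable_snd (hkm.comp (by fun_prop))
    exact ((measurable_const (a := (1 : ℝ))).indicator this).aestronglyMeasurable
  have hint : Integrable (fun p : ℝ × ℝ => ψ p.1 * (k (p.1 - p.2) * q p.2))
      (volume.prod volume) :=
    (integrable_lineConv_integrand hk hq).bdd_mul hψm.comp_fst
      (Filter.Eventually.of_forall fun p => hψb p.1)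
  have hvol : ∀ p : ℝ × ℝ, (volume.restrict (Ioi 0)).real (Iio (k (p.1 - p.2))) =
      k (p.1 - p.2) := fun p => by
    rw [measureReal_restrict_apply measurableSet_Iio, inter_comm, Ioi_inter_Iio,
      Real.volume_real_Ioo_of_le (hkn _), sub_zero]
  have hfin : ∀ p : ℝ × ℝ, (volume.restrict (Ioi 0)) (Iio (k (p.1 - p.2))) ≠ ⊤ := fun p => by
    rw [Measure.restrict_apply measurableSet_Iio, inter_comm, Ioi_inter_Iio]
    simp
  have hYint : Integrable Y ((volume.prod volume).prod (volume.restrict (Ioi 0))) := by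
    rw [integrable_prod_iff hYm]
    constructor
    · refine Filter.Eventually.of_forall fun p => ?_
      simp only [hset]
      exact (integrableOn_const (hfin p)).integrable_indicator measurableSet_Iio
    · refine hint.norm.congr (Filter.Eventually.of_forall fun p => ?_)
      simp only [hset, norm_indicator_eq_indicator_norm]
      rw [integral_indicator_const _ measurableSet_Iio, hvol, norm_mul, norm_mul, norm_mul,
        Real.norm_of_nonneg (hkn _), smul_eq_mul]
      ring
  have e1 : ∫ t in Ioo 0 T, lineConv k q t * lineConv (unitKernel T) q t =
      ∫ p, ψ p.1 * (k (p.1 - p.2) * q p.2) ∂(volume.prod volume) := by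
    rw [integral_prod _ hint, ← integral_indicator measurableSet_Ioo]
    refine integral_congr_ae (Filter.Eventually.of_forall fun t => ?_)
    simp only [integral_const_mul]
    by_cases ht : t ∈ Ioo 0 T
    · rw [indicator_of_mem ht, lineConv_unitKernel_eq_primitive hq0 ht, hψ,
        indicator_of_mem ht, mul_comm]
      rfl
    · simp [hψ, indicator_of_notMem ht]
  have e2 : ∫ p, ψ p.1 * (k (p.1 - p.2) * q p.2) ∂(volume.prod volume) =
      ∫ lam in Ioi 0, ∫ p, Y (p, lam) ∂(volume.prod volume) := by
    rw [← integral_prod_symm _ hYint, integral_prod _ hYint]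
    refine integral_congr_ae (Filter.Eventually.of_forall fun p => ?_)
    simp only [hset]
    rw [integral_indicator_const _ measurableSet_Iio, hvol, smul_eq_mul]
    ring
  rw [e1, e2]
  refine integral_nonneg_of_ae ?_
  filter_upwards [hYint.prod_left_ae, ae_restrict_mem measurableSet_Ioi] with lam hl hlam
  obtain ⟨a, ha, ha1, ha2⟩ := exists_initial_interval hlam hk0 hanti
  rw [integral_prod _ hl]
  have := integral_primitive_mul_shift_nonneg (T := T) ha hφc hφ0
  rw [← integral_indicator measurableSet_Ioo] at this
  refine this.trans_eq (integral_congr_ae (Filter.Eventually.of_forall fun t => ?_))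
  simp only [hY, integral_const_mul]
  rw [integral_indicator_mul_eq_primitive_sub ha ha1 ha2 hq, hψ]
  by_cases ht : t ∈ Ioo 0 T
  · simp [indicator_of_mem ht, hφ]
  · simp [indicator_of_notMem ht]

/-! ### The regularized time kernels -/

/-- The pairing of a backward convolution `∫_t^T l(r - t) φ(r) dr` with a function `b`. -/
theorem integral_backwardConv_mul {T : ℝ} {l b φ : ℝ → ℝ} (hl : Integrable l)
    (hl0 : ∀ s ≤ 0, l s = 0) (hb : Integrable b) (hb0 : ∀ s ≤ 0, b s = 0)
    (hφ : AEStronglyMeasurable φ) {C : ℝ} (hC : ∀ t, |φ t| ≤ C) (hφT : ∀ t, T ≤ t → φ t = 0) :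
    ∫ t in Ioo 0 T, (∫ r in Ioo 0 T, l (r - t) * φ r) * b t = ∫ t, φ t * lineConv l b t := by
  rw [integral_mul_lineConv hl hb hφ hC, ← integral_indicator measurableSet_Ioo]
  refine integral_congr_ae (Filter.Eventually.of_forall fun t => ?_)
  by_cases ht : t ∈ Ioo 0 T
  · rw [indicator_of_mem ht]
    simp only
    congr 1
    rw [← integral_indicator measurableSet_Ioo]
    refine integral_congr_ae (Filter.Eventually.of_forall fun r => ?_)
    by_cases hr : r ∈ Ioo 0 T
    · rw [indicator_of_mem hr]
    · rw [indicator_of_notMem hr]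
      rcases le_or_gt r 0 with h | h
      · simp [hl0 (r - t) (by linarith [ht.1])]
      · simp [hφT r (by simpa [h] using hr)]
  · rw [indicator_of_notMem ht]
    rcases le_or_gt t 0 with h | h
    · simp [hb0 t h]
    · have htT : T ≤ t := by simpa [h] using ht
      simp only
      rw [integral_eq_zero_of_ae, zero_mul]
      refine Filter.Eventually.of_forall fun r => ?_
      rcases le_or_gt r t with h' | h'
      · simp [hl0 (r - t) (by linarith)]
      · simp [hφT r (by linarith)]

/-- The kernel `β` of `f ↦ - ∂_t S* S f`, where `S` is the Steklov average on `(0,T)`. -/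
def stepKernel (T h r s : ℝ) : ℝ :=
  h⁻¹ * (unitKernel T r * steklovKernel h (r - s) -
    unitKernel T (r + h) * steklovKernel h (r + h - s))

/-- The kernel of `f ↦ - ∂_t η` for the test function `η = l ⋆ S* S f`. -/
def testDerivKernel (T h : ℝ) (l : ℝ → ℝ) (t s : ℝ) : ℝ :=
  ∫ r in Ioo 0 T, l (r - t) * stepKernel T h r s

/-- The kernel of `f ↦ η` for the test function `η = l ⋆ S* S f`. -/
def testKernel (T h : ℝ) (l : ℝ → ℝ) (t s : ℝ) : ℝ :=
  ∫ r in Ioo t T, testDerivKernel T h l r s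

theorem abs_unitKernel_le (T r : ℝ) : |unitKernel T r| ≤ 1 := by
  unfold unitKernel indicator
  split_ifs <;> simp

theorem measurable_stepKernel (T h : ℝ) : Measurable fun p : ℝ × ℝ => stepKernel T h p.1 p.2 := by
  have h1 := measurable_unitKernel T
  have h2 := measurable_steklovKernel h
  unfold stepKernel
  fun_prop

theorem abs_stepKernel_le {T h : ℝ} (hh : 0 < h) (r s : ℝ) :
    |stepKernel T h r s| ≤ h⁻¹ * (h⁻¹ + h⁻¹) := by
  have hp : 0 < h⁻¹ := by positivity
  have key : ∀ x y, |unitKernel T x * steklovKernel h y| ≤ h⁻¹ := fun x y => by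
    rw [abs_mul]
    calc _ ≤ 1 * h⁻¹ := mul_le_mul (abs_unitKernel_le T x) (abs_steklovKernel_le hh y)
          (abs_nonneg _) zero_le_one
      _ = h⁻¹ := one_mul _
  rw [stepKernel, abs_mul, abs_of_pos hp]
  exact mul_le_mul_of_nonneg_left ((abs_sub _ _).trans (add_le_add (key _ _) (key _ _))) hp.le

theorem measurable_testDerivKernel {T h : ℝ} {l : ℝ → ℝ} (hl : Measurable l) :
    Measurable fun p : ℝ × ℝ => testDerivKernel T h l p.1 p.2 := by
  have h1 := measurable_stepKernel T h
  have : Measurable fun q : (ℝ × ℝ) × ℝ => l (q.2 - q.1.1) * stepKernel T h q.2 q.1.2 := by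
    refine (hl.comp (by fun_prop)).mul (h1.comp (f := fun q : (ℝ × ℝ) × ℝ => (q.2, q.1.2)) ?_)
    fun_prop
  exact (this.stronglyMeasurable.integral_prod_right' (ν := volume.restrict (Ioo 0 T))).measurable

theorem measurable_testKernel {T h : ℝ} {l : ℝ → ℝ} (hl : Measurable l) :
    Measurable fun p : ℝ × ℝ => testKernel T h l p.1 p.2 := by
  have h1 := measurable_testDerivKernel (T := T) (h := h) hl
  have h2 : Measurable fun q : (ℝ × ℝ) × ℝ =>
      (if q.1.1 < q.2 ∧ q.2 < T then testDerivKernel T h l q.2 q.1.2 else 0) := by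
    refine Measurable.ite ?_ (h1.comp (f := fun q : (ℝ × ℝ) × ℝ => (q.2, q.1.2)) (by fun_prop))
      measurable_const
    exact (measurableSet_lt (measurable_fst.comp measurable_fst) measurable_snd).inter
      (measurableSet_lt measurable_snd measurable_const)
  have h3 := (h2.stronglyMeasurable.integral_prod_right' (ν := volume)).measurable
  convert h3 using 2 with p
  rw [testKernel, ← integral_indicator measurableSet_Ioo]
  simp only [indicator, mem_Ioo]

theorem abs_testDerivKernel_le {T h : ℝ} (hh : 0 < h) {l : ℝ → ℝ} (hl : Integrable l) (t s : ℝ) :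
    |testDerivKernel T h l t s| ≤ (∫ r, |l r|) * (h⁻¹ * (h⁻¹ + h⁻¹)) := by
  have hl' : Integrable fun r => |l (r - t)| := (hl.comp_sub_right t).abs
  calc |testDerivKernel T h l t s|
      ≤ ∫ r in Ioo 0 T, |l (r - t)| * (h⁻¹ * (h⁻¹ + h⁻¹)) := by
        rw [testDerivKernel, ← Real.norm_eq_abs]
        refine norm_integral_le_of_norm_le (hl'.integrableOn.mul_const _)
          (Filter.Eventually.of_forall fun r => ?_)
        rw [norm_mul]
        exact mul_le_mul_of_nonneg_left (abs_stepKernel_le hh r s) (norm_nonneg _)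
    _ ≤ (∫ r, |l (r - t)|) * (h⁻¹ * (h⁻¹ + h⁻¹)) := by
        rw [integral_mul_const]
        refine mul_le_mul_of_nonneg_right ?_ (by positivity)
        exact setIntegral_le_integral hl' (Filter.Eventually.of_forall fun _ => abs_nonneg _)
    _ = _ := by rw [integral_sub_right_eq_self (fun r => |l r|) t]

theorem abs_testKernel_le {T h : ℝ} (hT : 0 < T) (hh : 0 < h) {l : ℝ → ℝ} (hl : Integrable l)
    {t : ℝ} (ht : 0 < t) (s : ℝ) :
    |testKernel T h l t s| ≤ (∫ r, |l r|) * (h⁻¹ * (h⁻¹ + h⁻¹)) * T := by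
  have h0 : 0 ≤ (∫ r, |l r|) * (h⁻¹ * (h⁻¹ + h⁻¹)) :=
    mul_nonneg (integral_nonneg fun _ => abs_nonneg _) (by positivity)
  rw [testKernel, ← Real.norm_eq_abs]
  refine (norm_setIntegral_le_of_norm_le_const (C := (∫ r, |l r|) * (h⁻¹ * (h⁻¹ + h⁻¹))) (by simp)
    fun r _ => abs_testDerivKernel_le hh hl r s).trans ?_
  refine mul_le_mul_of_nonneg_left ?_ h0
  rw [Real.volume_real_Ioo]
  exact max_le (by linarith) hT.le

/-- A `PC` pair truncated to `(0,T)` and extended by zero; the identity `k * l = 1` survives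
below time `T`. -/
structure IsTruncatedPair (T : ℝ) (k l : ℝ → ℝ) : Prop where
  measurable_left : Measurable k
  measurable_right : Measurable l
  integrable_left : Integrable k
  integrable_right : Integrable l
  left_eq_zero : ∀ t, t ∉ Ioo 0 T → k t = 0
  right_eq_zero : ∀ t ≤ 0, l t = 0
  nonneg : ∀ t, 0 ≤ k t
  antitone : AntitoneOn k (Ioo 0 T)
  lineConv_eq : ∀ᵐ t, t < T → lineConv k l t = unitKernel T t

theorem IsTruncatedPair.left_of_nonpos {T : ℝ} {k l : ℝ → ℝ} (h : IsTruncatedPair T k l) :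
    ∀ t ≤ 0, k t = 0 := fun t ht => h.left_eq_zero t (by simp [ht.not_gt])

/-- `k * (l * g) = 1 * g` below time `T`. -/
theorem IsTruncatedPair.lineConv_lineConv {T : ℝ} {k l g : ℝ → ℝ} (h : IsTruncatedPair T k l)
    (hg : Integrable g) (hg0 : ∀ s ≤ 0, g s = 0) :
    ∀ᵐ t, t < T → lineConv k (lineConv l g) t = lineConv (unitKernel T) g t := by
  filter_upwards [lineConv_assoc h.integrable_left h.integrable_right hg] with t ht htT
  rw [← ht]
  exact lineConv_congr_left h.lineConv_eq hg0 htT.le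

theorem IsTruncatedPair.lineConv_lineConv' {T : ℝ} {k l g : ℝ → ℝ} (h : IsTruncatedPair T k l)
    (hg : Integrable g) (hg0 : ∀ s ≤ 0, g s = 0) :
    ∀ᵐ t, t < T → lineConv l (lineConv k g) t = lineConv (unitKernel T) g t := by
  filter_upwards [lineConv_assoc h.integrable_right h.integrable_left hg] with t ht htT
  rw [← ht, lineConv_comm l k]
  exact lineConv_congr_left h.lineConv_eq hg0 htT.le

/-- Truncation of a `PC` pair. The function `l` is only determined almost everywhere and is replaced
by a measurable representative; `k` keeps its values, which monotonicity makes measurable. -/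
theorem IsPCPair.exists_truncatedPair {k l : ℝ → ℝ} (h : IsPCPair k l) (T : ℝ) :
    ∃ l', IsTruncatedPair T ((Ioo 0 T).indicator k) l' := by
  have hk : IntegrableOn k (Ioo 0 T) :=
    (h.locInt_k.integrableOn_compact_subset Icc_subset_Ici_self isCompact_Icc).mono_set
      Ioo_subset_Icc_self
  have hl : IntegrableOn l (Ioo 0 T) :=
    (h.locInt_l.integrableOn_compact_subset Icc_subset_Ici_self isCompact_Icc).mono_set
      Ioo_subset_Icc_self
  have hl1 : Integrable ((Ioo 0 T).indicator l) := hl.integrable_indicator measurableSet_Ioo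
  set lm : ℝ → ℝ := (Ioo 0 T).indicator (hl1.1.mk _) with hlm
  have hlm1 : lm =ᵐ[volume] (Ioo 0 T).indicator l := by
    filter_upwards [hl1.1.ae_eq_mk] with t ht
    by_cases htI : t ∈ Ioo 0 T
    · rw [hlm, indicator_of_mem htI, ← ht]
    · rw [hlm, indicator_of_notMem htI, indicator_of_notMem htI]
  have hkn : ∀ t, 0 ≤ (Ioo 0 T).indicator k t := fun t =>
    indicator_nonneg (fun s hs => h.nonneg s hs.1) t
  have hanti : AntitoneOn k (Ioo 0 T) := h.antitone.mono fun t ht => ht.1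
  refine ⟨lm, ?_, hl1.1.measurable_mk.indicator measurableSet_Ioo,
    hk.integrable_indicator measurableSet_Ioo, hl1.congr hlm1.symm,
    fun t ht => indicator_of_notMem ht _, fun t ht => indicator_of_notMem (by simp [ht.not_gt]) _,
    hkn, ?_, ?_⟩
  · refine measurable_of_Ioi fun c => ?_
    rcases lt_or_ge c 0 with hc | hc
    · convert MeasurableSet.univ
      ext t
      simpa using hc.trans_le (hkn t)
    · have : (Ioo 0 T).indicator k ⁻¹' Ioi c = {t ∈ Ioo 0 T | c < k t} := by
        ext t
        by_cases ht : t ∈ Ioo 0 T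
        · simp only [mem_preimage, indicator_of_mem ht, mem_Ioi, mem_ofPred_eq, ht, true_and]
        · simp only [mem_preimage, indicator_of_notMem ht, mem_Ioi, mem_ofPred_eq, ht, false_and,
            iff_false, not_lt, hc]
      rw [this]
      refine OrdConnected.measurableSet ⟨fun x hx y hy z hz => ?_⟩
      have hzI : z ∈ Ioo 0 T := ⟨hx.1.1.trans_le hz.1, hz.2.trans_lt hy.1.2⟩
      exact ⟨hzI, hy.2.trans_le (hanti hzI hy.1 hz.2)⟩
  · intro x hx y hy hxy
    rw [indicator_of_mem hx, indicator_of_mem hy]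
    exact hanti hx hy hxy
  · have h1 := (ae_restrict_iff' measurableSet_Ioi).1 h.conv_eq_one
    filter_upwards [h1] with t ht htT
    have e : lineConv ((Ioo 0 T).indicator k) lm t =
        lineConv ((Ioo 0 T).indicator k) ((Ioo 0 T).indicator l) t := by
      refine integral_congr_ae ?_
      filter_upwards [hlm1] with s hs
      rw [hs]
    rw [e]
    rcases le_or_gt t 0 with h0 | h0
    · rw [unitKernel_of_nonpos T t h0]
      exact lineConv_eq_zero (fun s hs => indicator_of_notMem (by simp [hs.not_gt]) _)
        (fun s hs => indicator_of_notMem (by simp [hs.not_gt]) _) h0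
    · rw [unitKernel, indicator_of_mem (show t ∈ Ioo 0 T from ⟨h0, htT⟩), ← ht h0, lineConv,
        ← integral_indicator measurableSet_Ioo]
      refine integral_congr_ae (Filter.Eventually.of_forall fun s => ?_)
      simp only [indicator, mem_Ioo]
      by_cases hs : 0 < s ∧ s < t
      · rw [if_pos hs, if_pos ⟨by linarith, by linarith⟩, if_pos ⟨by linarith, by linarith⟩]
      · rw [if_neg hs]
        rcases not_and_or.1 hs with h' | h'
        · rw [if_neg (c := 0 < s ∧ s < T) (fun h2 => h' h2.1), mul_zero]
        · rw [if_neg (c := 0 < t - s ∧ t - s < T) (fun h2 => h' (by linarith [h2.1])), zero_mul]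

theorem setIntegral_kernel_eq_lineConv (T : ℝ) (a f : ℝ → ℝ) (t : ℝ) :
    ∫ s in Ioo 0 T, a (t - s) * f s = lineConv a ((Ioo 0 T).indicator f) t := by
  rw [lineConv, ← integral_indicator measurableSet_Ioo]
  refine integral_congr_ae (Filter.Eventually.of_forall fun s => ?_)
  simp only [indicator]
  split_ifs <;> simp

theorem causal_setIntegral_eq_lineConv {T t : ℝ} (ht : t ∈ Ioo 0 T) (k v : ℝ → ℝ) :
    ∫ s in Ioo 0 t, k (t - s) * v s =
      lineConv ((Ioo 0 T).indicator k) ((Ioo 0 T).indicator v) t := by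
  rw [lineConv, ← integral_indicator measurableSet_Ioo]
  refine integral_congr_ae (Filter.Eventually.of_forall fun s => ?_)
  have h1 := ht.1
  have h2 := ht.2
  simp only [indicator, mem_Ioo]
  by_cases hs : 0 < s ∧ s < t
  · rw [if_pos hs, if_pos ⟨by linarith, by linarith⟩, if_pos ⟨by linarith, by linarith⟩]
  · rw [if_neg hs]
    rcases not_and_or.1 hs with h' | h'
    · rw [if_neg (c := 0 < s ∧ s < T) (fun h2 => h' h2.1), mul_zero]
    · rw [if_neg (c := 0 < t - s ∧ t - s < T) (fun h2 => h' (by linarith [h2.1])), zero_mul]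

section

variable {T h : ℝ} {l f : ℝ → ℝ}

theorem abs_lineConv_steklovKernel_le (hh : 0 < h) (hf : IntegrableOn f (Ioo 0 T)) (t : ℝ) :
    |lineConv (steklovKernel h) ((Ioo 0 T).indicator f) t| ≤ h⁻¹ * ∫ s in Ioo 0 T, |f s| := by
  rw [← setIntegral_kernel_eq_lineConv, ← integral_const_mul, ← Real.norm_eq_abs]
  refine norm_integral_le_of_norm_le (hf.abs.const_mul _) (Filter.Eventually.of_forall fun s => ?_)
  rw [norm_mul]
  exact mul_le_mul_of_nonneg_right (abs_steklovKernel_le hh _) (norm_nonneg _)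

theorem integrable_steklovKernel (h : ℝ) : Integrable (steklovKernel h) :=
  (integrableOn_const (by simp)).integrable_indicator measurableSet_Ioc

theorem integrableOn_bdd_kernel_mul {κ : ℝ → ℝ} (hκ : Measurable κ) {C : ℝ} (hC : ∀ s, |κ s| ≤ C)
    (hf : IntegrableOn f (Ioo 0 T)) : IntegrableOn (fun s => κ s * f s) (Ioo 0 T) :=
  Integrable.bdd_mul hf hκ.aestronglyMeasurable (Filter.Eventually.of_forall hC)

theorem setIntegral_stepKernel_mul (hh : 0 < h) (hf : IntegrableOn f (Ioo 0 T)) (r : ℝ) :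
    ∫ s in Ioo 0 T, stepKernel T h r s * f s =
      h⁻¹ * (unitKernel T r * lineConv (steklovKernel h) ((Ioo 0 T).indicator f) r -
        unitKernel T (r + h) * lineConv (steklovKernel h) ((Ioo 0 T).indicator f) (r + h)) := by
  have hi : ∀ x, IntegrableOn (fun s => unitKernel T x * (steklovKernel h (x - s) * f s))
      (Ioo 0 T) := fun x =>
    (integrableOn_bdd_kernel_mul ((measurable_steklovKernel h).comp (by fun_prop))
      (fun s => abs_steklovKernel_le hh (x - s)) hf).const_mul _
  rw [← setIntegral_kernel_eq_lineConv, ← setIntegral_kernel_eq_lineConv, ← integral_const_mul,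
    ← integral_const_mul, ← integral_sub (hi r) (hi (r + h)), ← integral_const_mul]
  refine integral_congr_ae (Filter.Eventually.of_forall fun s => ?_)
  simp only [stepKernel]
  ring

theorem setIntegral_testDerivKernel_mul (hh : 0 < h) (hl : Integrable l)
    (hf : IntegrableOn f (Ioo 0 T)) (t : ℝ) :
    ∫ s in Ioo 0 T, testDerivKernel T h l t s * f s =
      ∫ r in Ioo 0 T, l (r - t) * ∫ s in Ioo 0 T, stepKernel T h r s * f s := by
  have hint : Integrable (Function.uncurry fun r s => stepKernel T h r s * (l (r - t) * f s))
      ((volume.restrict (Ioo 0 T)).prod (volume.restrict (Ioo 0 T))) := by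
    refine Integrable.bdd_mul (Integrable.mul_prod (hl.comp_sub_right t).integrableOn hf)
      (measurable_stepKernel T h).aestronglyMeasurable
      (Filter.Eventually.of_forall fun p => abs_stepKernel_le hh p.1 p.2)
  have e := integral_integral_swap hint
  calc _ = ∫ s in Ioo 0 T, ∫ r in Ioo 0 T, stepKernel T h r s * (l (r - t) * f s) := by
        refine integral_congr_ae (Filter.Eventually.of_forall fun s => ?_)
        simp only [testDerivKernel, ← integral_mul_const]
        refine integral_congr_ae (Filter.Eventually.of_forall fun r => ?_)
        simp only
        ring
    _ = _ := by
        rw [← e]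
        refine integral_congr_ae (Filter.Eventually.of_forall fun r => ?_)
        simp only [← integral_const_mul]
        refine integral_congr_ae (Filter.Eventually.of_forall fun s => ?_)
        simp only
        ring

theorem setIntegral_testKernel_mul (hh : 0 < h) (hlm : Measurable l) (hl : Integrable l)
    (hf : IntegrableOn f (Ioo 0 T)) (t : ℝ) :
    ∫ s in Ioo 0 T, testKernel T h l t s * f s =
      ∫ r in Ioo t T, ∫ s in Ioo 0 T, testDerivKernel T h l r s * f s := by
  have hint : Integrable (fun p : ℝ × ℝ => testDerivKernel T h l p.1 p.2 * f p.2)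
      ((volume.restrict (Ioo t T)).prod (volume.restrict (Ioo 0 T))) := by
    refine Integrable.bdd_mul (Integrable.comp_snd hf _)
      (measurable_testDerivKernel hlm).aestronglyMeasurable
      (Filter.Eventually.of_forall fun p => abs_testDerivKernel_le hh hl p.1 p.2)
  rw [integral_integral_swap hint]
  simp only [testKernel, integral_mul_const]

/-- The adjoint relation `∫ (-∂_t S* S f) (1 * v) = ∫ S f S v` for the Steklov average `S`. -/
theorem integral_stepKernel_mul_primitive (hh : 0 < h) (hf : IntegrableOn f (Ioo 0 T))
    {v : ℝ → ℝ} (hv : Integrable v) (hv0 : ∀ s ≤ 0, v s = 0) :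
    ∫ t, (∫ s in Ioo 0 T, stepKernel T h t s * f s) * lineConv (unitKernel T) v t =
      ∫ t in Ioo 0 T, lineConv (steklovKernel h) ((Ioo 0 T).indicator f) t *
        lineConv (steklovKernel h) v t := by
  simp only [setIntegral_stepKernel_mul hh hf]
  have hfi : Integrable ((Ioo 0 T).indicator f) := hf.integrable_indicator measurableSet_Ioo
  have hVi := integrable_lineConv (integrable_unitKernel T) hv
  set Sf := lineConv (steklovKernel h) ((Ioo 0 T).indicator f) with hSf
  have hSfm : AEStronglyMeasurable Sf :=
    (integrable_lineConv (integrable_steklovKernel h) hfi).1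
  have hSfm' : AEStronglyMeasurable fun t => Sf (t + h) :=
    ((integrable_lineConv (integrable_steklovKernel h) hfi).comp_add_right h).1
  have hb : ∀ t, ‖unitKernel T t * Sf t‖ ≤ 1 * (h⁻¹ * ∫ s in Ioo 0 T, |f s|) := fun t => by
    rw [norm_mul]
    exact mul_le_mul (abs_unitKernel_le T t) (abs_lineConv_steklovKernel_le hh hf t)
      (norm_nonneg _) zero_le_one
  rw [integral_forward_diff_mul (F := fun t => unitKernel T t * Sf t) h
    (hVi.bdd_mul ((measurable_unitKernel T).aestronglyMeasurable.mul hSfm)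
      (Filter.Eventually.of_forall hb))
    (hVi.bdd_mul (((measurable_unitKernel T).comp (by fun_prop)).aestronglyMeasurable.mul hSfm')
      (Filter.Eventually.of_forall fun t => hb (t + h))), ← integral_indicator measurableSet_Ioo]
  refine integral_congr_ae ?_
  filter_upwards [diffQuot_lineConv_unitKernel (T := T) hh hv hv0] with t ht
  by_cases htI : t ∈ Ioo 0 T
  · simp [unitKernel, indicator_of_mem htI, ← ht htI.2]
  · simp [unitKernel, indicator_of_notMem htI]

theorem setIntegral_testDerivKernel_mul_lineConv (hh : 0 < h) (hl : Integrable l)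
    (hl0 : ∀ s ≤ 0, l s = 0) (hf : IntegrableOn f (Ioo 0 T)) {b : ℝ → ℝ} (hb : Integrable b)
    (hb0 : ∀ s ≤ 0, b s = 0) :
    ∫ t in Ioo 0 T, (∫ s in Ioo 0 T, testDerivKernel T h l t s * f s) * b t =
      ∫ t, (∫ s in Ioo 0 T, stepKernel T h t s * f s) * lineConv l b t := by
  simp only [setIntegral_testDerivKernel_mul hh hl hf]
  refine integral_backwardConv_mul hl hl0 hb hb0 (C := h⁻¹ * (h⁻¹ + h⁻¹) * ∫ s in Ioo 0 T, |f s|)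
    ?_ (fun t => ?_) (fun t ht => ?_)
  · have : AEStronglyMeasurable (fun p : ℝ × ℝ => stepKernel T h p.1 p.2 * f p.2)
        (volume.prod (volume.restrict (Ioo 0 T))) :=
      (measurable_stepKernel T h).aestronglyMeasurable.mul hf.1.comp_snd
    exact this.integral_prod_right'
  · rw [← integral_const_mul, ← Real.norm_eq_abs]
    refine norm_integral_le_of_norm_le (hf.abs.const_mul _)
      (Filter.Eventually.of_forall fun s => ?_)
    rw [norm_mul]
    exact mul_le_mul_of_nonneg_right (abs_stepKernel_le hh _ _) (norm_nonneg _)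
  · rw [setIntegral_stepKernel_mul hh hf]
    simp [unitKernel, not_lt.2 ht, not_lt.2 (show T ≤ t + h by linarith)]

/-- Testing `∂_t (k * v)` with `η = l ⋆ S* S f` gives `∫ S f S v`. -/
theorem IsTruncatedPair.integral_testDeriv_mul {k : ℝ → ℝ} (hkl : IsTruncatedPair T k l)
    (hh : 0 < h) (hf : IntegrableOn f (Ioo 0 T)) {v : ℝ → ℝ} (hv : IntegrableOn v (Ioo 0 T)) :
    ∫ t in Ioo 0 T, (∫ s in Ioo 0 T, testDerivKernel T h l t s * f s) *
        lineConv k ((Ioo 0 T).indicator v) t =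
      ∫ t in Ioo 0 T, lineConv (steklovKernel h) ((Ioo 0 T).indicator f) t *
        lineConv (steklovKernel h) ((Ioo 0 T).indicator v) t := by
  have hvi : Integrable ((Ioo 0 T).indicator v) := hv.integrable_indicator measurableSet_Ioo
  have hv0 : ∀ s ≤ 0, (Ioo 0 T).indicator v s = 0 := fun s hs =>
    indicator_of_notMem (by simp [hs.not_gt]) _
  rw [setIntegral_testDerivKernel_mul_lineConv hh hkl.integrable_right hkl.right_eq_zero hf
      (integrable_lineConv hkl.integrable_left hvi)
      (fun s hs => lineConv_eq_zero hkl.left_of_nonpos hv0 hs),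
    ← integral_stepKernel_mul_primitive hh hf hvi hv0]
  refine integral_congr_ae ?_
  filter_upwards [hkl.lineConv_lineConv' hvi hv0] with t ht
  rcases lt_or_ge t T with h1 | h1
  · rw [ht h1]
  · rw [setIntegral_stepKernel_mul hh hf]
    simp [unitKernel, not_lt.2 h1, not_lt.2 (show T ≤ t + h by linarith)]

/-- The operator `f ↦ l ⋆ S* S f` is nonnegative: its quadratic form is `∫ S g (l * S g)`, and with
`q = ∂_t (l * S g)` one has `S g = k * q` and `l * S g = 1 * q`. -/
theorem IsTruncatedPair.integral_mul_testKernel_nonneg {k : ℝ → ℝ} (hkl : IsTruncatedPair T k l)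
    (hh : 0 < h) (hf : IntegrableOn f (Ioo 0 T)) :
    0 ≤ ∫ t in Ioo 0 T, f t * ∫ s in Ioo 0 T, testKernel T h l t s * f s := by
  have hl := hkl.integrable_right
  have hfi : Integrable ((Ioo 0 T).indicator f) := hf.integrable_indicator measurableSet_Ioo
  have hf0 : ∀ s ≤ 0, (Ioo 0 T).indicator f s = 0 := fun s hs =>
    indicator_of_notMem (by simp [hs.not_gt]) _
  set g := (Ioo 0 T).indicator f with hg
  set E : ℝ → ℝ := (Ioo 0 T).indicator fun t => ∫ s in Ioo 0 T, testDerivKernel T h l t s * f s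
    with hE
  have hEm : AEStronglyMeasurable E := by
    have : AEStronglyMeasurable (fun p : ℝ × ℝ => testDerivKernel T h l p.1 p.2 * f p.2)
        (volume.prod (volume.restrict (Ioo 0 T))) :=
      (measurable_testDerivKernel hkl.measurable_right).aestronglyMeasurable.mul hf.1.comp_snd
    exact (this.integral_prod_right').indicator measurableSet_Ioo
  have hEb : ∀ t, |E t| ≤ ((∫ r, |l r|) * (h⁻¹ * (h⁻¹ + h⁻¹))) * ∫ s in Ioo 0 T, |f s| := by
    intro t
    rw [← Real.norm_eq_abs, hE]
    refine (norm_indicator_le_norm_self _ _).trans ?_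
    rw [← integral_const_mul]
    refine norm_integral_le_of_norm_le (hf.abs.const_mul _)
      (Filter.Eventually.of_forall fun s => ?_)
    rw [norm_mul]
    exact mul_le_mul_of_nonneg_right (abs_testDerivKernel_le hh hl _ _) (norm_nonneg _)
  have hp := integrable_lineConv hl hfi
  have hp0 : ∀ s ≤ 0, lineConv l g s = 0 := fun s hs =>
    lineConv_eq_zero hkl.right_eq_zero hf0 hs
  -- Both time integrations are moved to the other factor.
  have e1 : ∫ t in Ioo 0 T, f t * ∫ s in Ioo 0 T, testKernel T h l t s * f s =
      ∫ t in Ioo 0 T, (∫ r in Ioo 0 T, unitKernel T (r - t) * E r) * g t := by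
    refine setIntegral_congr_fun measurableSet_Ioo fun t ht => ?_
    rw [setIntegral_testKernel_mul hh hkl.measurable_right hl hf, hg, indicator_of_mem ht, mul_comm]
    congr 1
    rw [← integral_indicator measurableSet_Ioo, ← integral_indicator measurableSet_Ioo]
    refine integral_congr_ae (Filter.Eventually.of_forall fun r => ?_)
    have h1 := ht.1
    have h2 := ht.2
    simp only [hE, unitKernel, indicator, mem_Ioo]
    split_ifs <;> first | (exfalso; grind) | simp
  have e2 : ∫ t, E t * lineConv (unitKernel T) g t =
      ∫ t in Ioo 0 T, (∫ s in Ioo 0 T, testDerivKernel T h l t s * f s) *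
        lineConv (unitKernel T) g t := by
    rw [← integral_indicator measurableSet_Ioo]
    refine integral_congr_ae (Filter.Eventually.of_forall fun t => ?_)
    simp only [hE, indicator]
    split_ifs <;> simp
  have e3 : ∫ t, (∫ s in Ioo 0 T, stepKernel T h t s * f s) *
        lineConv l (lineConv (unitKernel T) g) t =
      ∫ t, (∫ s in Ioo 0 T, stepKernel T h t s * f s) *
        lineConv (unitKernel T) (lineConv l g) t := by
    refine integral_congr_ae ?_
    filter_upwards [lineConv_assoc hl (integrable_unitKernel T) hfi,
      lineConv_assoc (integrable_unitKernel T) hl hfi] with t h1 h2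
    rw [← h1, ← h2, lineConv_comm l]
  rw [e1, integral_backwardConv_mul (integrable_unitKernel T) (unitKernel_of_nonpos T) hfi hf0
      hEm hEb (fun t ht => indicator_of_notMem (by simp [ht]) _), e2,
    setIntegral_testDerivKernel_mul_lineConv hh hl hkl.right_eq_zero hf
      (integrable_lineConv (integrable_unitKernel T) hfi)
      (fun s hs => lineConv_eq_zero (unitKernel_of_nonpos T) hf0 hs), e3,
    integral_stepKernel_mul_primitive hh hf hp hp0]
  -- With `q = h⁻¹ (p - p(· - h))`, `p = l * g`, one has `k * q = S g` and `1 * q = S p` on `(0,T)`.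
  have hq := integrable_diffQuot h hp
  refine (integral_lineConv_antitone_nonneg hkl.measurable_left hkl.integrable_left
    hkl.left_eq_zero hkl.nonneg hkl.antitone hq
    (fun s hs => diffQuot_eq_zero hh hp0 hs)).trans_eq ?_
  refine integral_congr_ae ?_
  have s1 := hkl.lineConv_lineConv hfi hf0
  have s2 := (measurePreserving_sub_right (volume : Measure ℝ) h).quasiMeasurePreserving.ae s1
  filter_upwards [ae_restrict_mem measurableSet_Ioo, ae_restrict_of_ae s1, ae_restrict_of_ae s2,
    ae_restrict_of_ae (lineConv_diffQuot h hkl.integrable_left hp),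
    ae_restrict_of_ae (lineConv_diffQuot h (integrable_unitKernel T) hp),
    ae_restrict_of_ae (diffQuot_lineConv_unitKernel (T := T) hh hfi hf0),
    ae_restrict_of_ae (diffQuot_lineConv_unitKernel (T := T) hh hp hp0)]
    with t ht t1 t2 t3 t4 t5 t6
  rw [t3, t4, t6 ht.2, ← t5 ht.2]
  simp only [diffQuot]
  rw [t1 ht.2, t2 (by linarith [ht.2])]

end

/-! ### Bounded time kernels acting on functions on the cylinder -/

theorem cylMeasure_eq_prod {N : ℕ} (T : ℝ) (Ω : Set (Space N)) :
    cylMeasure T Ω = (volume.restrict (Ioo 0 T)).prod (volume.restrict Ω) := by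
  rw [cylMeasure, cylinder, Measure.volume_eq_prod, Measure.prod_restrict]

/-- `(K f)(t, x) = ∫_0^T κ(t, s) f(s, x) ds`. -/
def kernelOp {N : ℕ} {F : Type*} [NormedAddCommGroup F] [NormedSpace ℝ F] (T : ℝ)
    (κ : ℝ → ℝ → ℝ) (f : ℝ × Space N → F) (z : ℝ × Space N) : F :=
  ∫ s in Ioo 0 T, κ z.1 s • f (s, z.2)

section

variable {N : ℕ} {T : ℝ} {Ω : Set (Space N)} {F : Type*} [NormedAddCommGroup F]

theorem isFiniteMeasure_restrict_of_isBounded (hΩ : Bornology.IsBounded Ω) :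
    IsFiniteMeasure (volume.restrict Ω) :=
  ⟨by simpa using hΩ.measure_lt_top⟩

theorem aestronglyMeasurable_comp_time {f : ℝ × Space N → F}
    (hf : AEStronglyMeasurable f (cylMeasure T Ω)) :
    AEStronglyMeasurable (fun q : (ℝ × Space N) × ℝ => f (q.2, q.1.2))
      ((cylMeasure T Ω).prod (volume.restrict (Ioo 0 T))) := by
  rw [cylMeasure_eq_prod] at *
  have h1 := measurePreserving_prodAssoc (volume.restrict (Ioo 0 T)) (volume.restrict Ω)
    (volume.restrict (Ioo 0 T))
  have h2 : AEStronglyMeasurable (fun q : ℝ × (Space N × ℝ) => f (q.2.2, q.2.1))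
      ((volume.restrict (Ioo 0 T)).prod
        ((volume.restrict Ω).prod (volume.restrict (Ioo 0 T)))) :=
    (hf.prod_swap).comp_snd
  exact h2.comp_measurePreserving h1

theorem sq_integral_le {μ : Measure ℝ} [IsFiniteMeasure μ] {g : ℝ → ℝ} (hg : Integrable g μ)
    (hg2 : Integrable (fun s => g s ^ 2) μ) :
    (∫ s, g s ∂μ) ^ 2 ≤ μ.real univ * ∫ s, g s ^ 2 ∂μ := by
  set M := ∫ s, g s ∂μ with hM
  set V := μ.real univ with hV
  have hV0 : 0 ≤ V := measureReal_nonneg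
  have key : 0 ≤ ∫ s, (V * g s - M) ^ 2 ∂μ := integral_nonneg fun s => sq_nonneg _
  have e : ∫ s, (V * g s - M) ^ 2 ∂μ = V * (V * (∫ s, g s ^ 2 ∂μ) - M ^ 2) := by
    have : ∀ s, (V * g s - M) ^ 2 = V ^ 2 * g s ^ 2 - 2 * V * M * g s + M ^ 2 := fun s => by ring
    simp only [this]
    have i1 : Integrable (fun s => V ^ 2 * g s ^ 2) μ := hg2.const_mul _
    have i2 : Integrable (fun s => 2 * V * M * g s) μ := hg.const_mul _
    rw [integral_add (f := fun s => V ^ 2 * g s ^ 2 - 2 * V * M * g s) (i1.sub i2)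
      (integrable_const _), integral_sub i1 i2, integral_const_mul, integral_const_mul,
      integral_const, ← hM, smul_eq_mul, ← hV]
    ring
  rw [e] at key
  rcases hV0.eq_or_lt with h0 | h0
  · have hμ : μ = 0 := by
      have : μ.real univ = 0 := h0.symm
      rwa [measureReal_eq_zero_iff, Measure.measure_univ_eq_zero] at this
    simp [hM, hμ]
  · have := nonneg_of_mul_nonneg_right key h0
    linarith

theorem MemLp.ae_section_integrableOn (hΩ : Bornology.IsBounded Ω) {f : ℝ × Space N → F}
    (hf : MemLp f 2 (cylMeasure T Ω)) :
    ∀ᵐ x ∂(volume.restrict Ω), IntegrableOn (fun t => f (t, x)) (Ioo 0 T) := by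
  have := isFiniteMeasure_restrict_of_isBounded hΩ
  rw [cylMeasure_eq_prod] at hf
  exact (hf.integrable (by norm_num)).prod_left_ae

theorem memLp_timeIntegral_norm (hΩ : Bornology.IsBounded Ω) {f : ℝ × Space N → F}
    (hf : MemLp f 2 (cylMeasure T Ω)) :
    MemLp (fun x => ∫ s in Ioo 0 T, ‖f (s, x)‖) 2 (volume.restrict Ω) := by
  have := isFiniteMeasure_restrict_of_isBounded hΩ
  have hsec := MemLp.ae_section_integrableOn hΩ hf
  rw [cylMeasure_eq_prod] at hf
  have hf2 := (memLp_two_iff_integrable_sq_norm hf.1).1 hf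
  have hm : AEStronglyMeasurable (fun x => ∫ s in Ioo 0 T, ‖f (s, x)‖) (volume.restrict Ω) :=
    (hf.1.norm.prod_swap).integral_prod_right'
  rw [memLp_two_iff_integrable_sq hm]
  refine (hf2.integral_prod_right.const_mul ((volume.restrict (Ioo 0 T)).real univ)).mono'
    (hm.pow 2) ?_
  filter_upwards [hsec, hf2.prod_left_ae] with x hx hx2
  rw [Real.norm_of_nonneg (sq_nonneg _)]
  exact sq_integral_le hx.norm hx2

theorem norm_kernelOp_le [NormedSpace ℝ F] {κ : ℝ → ℝ → ℝ} {C : ℝ}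
    (hC : ∀ t ∈ Ioo 0 T, ∀ s, |κ t s| ≤ C) {f : ℝ × Space N → F} {t : ℝ} (ht : t ∈ Ioo 0 T)
    {x : Space N} (hx : IntegrableOn (fun t => f (t, x)) (Ioo 0 T)) :
    ‖kernelOp T κ f (t, x)‖ ≤ C * ∫ s in Ioo 0 T, ‖f (s, x)‖ := by
  rw [← integral_const_mul]
  refine norm_integral_le_of_norm_le (hx.norm.const_mul _) (Filter.Eventually.of_forall fun s => ?_)
  rw [norm_smul]
  exact mul_le_mul_of_nonneg_right (hC t ht s) (norm_nonneg _)

theorem ae_cyl_of_ae_time {p : ℝ → Prop} (h : ∀ᵐ t ∂(volume.restrict (Ioo 0 T)), p t) :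
    ∀ᵐ z ∂(cylMeasure T Ω), p z.1 := by
  rw [cylMeasure_eq_prod]
  exact Measure.quasiMeasurePreserving_fst.ae h

theorem ae_cyl_of_ae_space {p : Space N → Prop} (h : ∀ᵐ x ∂(volume.restrict Ω), p x) :
    ∀ᵐ z ∂(cylMeasure T Ω), p z.2 := by
  rw [cylMeasure_eq_prod]
  exact Measure.quasiMeasurePreserving_snd.ae h

theorem ae_cyl_mem : ∀ᵐ z ∂(cylMeasure T Ω), z.1 ∈ Ioo 0 T :=
  ae_cyl_of_ae_time (ae_restrict_mem measurableSet_Ioo)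

theorem aestronglyMeasurable_kernelOp [NormedSpace ℝ F] {κ : ℝ → ℝ → ℝ}
    (hκ : Measurable fun p : ℝ × ℝ => κ p.1 p.2) {f : ℝ × Space N → F}
    (hf : AEStronglyMeasurable f (cylMeasure T Ω)) :
    AEStronglyMeasurable (kernelOp T κ f) (cylMeasure T Ω) := by
  have hm : AEStronglyMeasurable (fun q : (ℝ × Space N) × ℝ => κ q.1.1 q.2 • f (q.2, q.1.2))
      ((cylMeasure T Ω).prod (volume.restrict (Ioo 0 T))) := by
    refine AEStronglyMeasurable.smul ?_ (aestronglyMeasurable_comp_time hf)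
    exact (hκ.comp (f := fun q : (ℝ × Space N) × ℝ => (q.1.1, q.2))
      (by fun_prop)).aestronglyMeasurable
  exact hm.integral_prod_right'

theorem memLp_kernelOp [NormedSpace ℝ F] (hΩ : Bornology.IsBounded Ω) {κ : ℝ → ℝ → ℝ}
    (hκ : Measurable fun p : ℝ × ℝ => κ p.1 p.2) {C : ℝ}
    (hC : ∀ t ∈ Ioo 0 T, ∀ s, |κ t s| ≤ C) {f : ℝ × Space N → F}
    (hf : MemLp f 2 (cylMeasure T Ω)) : MemLp (kernelOp T κ f) 2 (cylMeasure T Ω) := by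
  have hM := ((memLp_timeIntegral_norm hΩ hf).comp_snd (volume.restrict (Ioo 0 T))).const_mul C
  rw [← cylMeasure_eq_prod] at hM
  refine hM.mono (aestronglyMeasurable_kernelOp hκ hf.1) ?_
  filter_upwards [ae_cyl_mem, ae_cyl_of_ae_space (MemLp.ae_section_integrableOn hΩ hf)]
    with z hz hx
  exact (norm_kernelOp_le hC hz hx).trans (le_abs_self _)

theorem continuous_gradient {φ : Space N → ℝ} (hφ : ContDiff ℝ ∞ φ) : Continuous (gradient φ) :=
  (InnerProductSpace.toDual ℝ (Space N)).symm.continuous.comp (hφ.continuous_fderiv (by simp))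

theorem exists_bound_gradient {φ : Space N → ℝ} (hφ : ContDiff ℝ ∞ φ)
    (hφc : HasCompactSupport φ) : ∃ C, ∀ x, ‖gradient φ x‖ ≤ C := by
  obtain ⟨C, hC⟩ := (hφc.fderiv ℝ).exists_bound_of_continuous (hφ.continuous_fderiv (by simp))
  exact ⟨C, fun x => by simpa [gradient] using hC x⟩

theorem isWeakGradient_of_integrableOn {v : Space N → ℝ} {G : Space N → Space N}
    (hv : IntegrableOn v Ω) (hG : IntegrableOn G Ω)
    (h : ∀ φ : Space N → ℝ, ContDiff ℝ ∞ φ → HasCompactSupport φ → tsupport φ ⊆ Ω →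
      ∫ x in Ω, v x • gradient φ x = -∫ x in Ω, φ x • G x) : IsWeakGradient Ω v G :=
  ⟨hv.locallyIntegrableOn, hG.locallyIntegrableOn, h⟩

/-- Bounded time kernels commute with the weak spatial gradient. -/
theorem IsL2H1.kernelOp (hΩ : Bornology.IsBounded Ω) {κ : ℝ → ℝ → ℝ}
    (hκ : Measurable fun p : ℝ × ℝ => κ p.1 p.2) {C : ℝ}
    (hC : ∀ t ∈ Ioo 0 T, ∀ s, |κ t s| ≤ C) {w : ℝ × Space N → ℝ} {G : ℝ × Space N → Space N}
    (hw : IsL2H1 T Ω w G) : IsL2H1 T Ω (kernelOp T κ w) (kernelOp T κ G) := by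
  have := isFiniteMeasure_restrict_of_isBounded hΩ
  have hw1 := memLp_kernelOp hΩ hκ hC hw.memLp
  have hG1 := memLp_kernelOp hΩ hκ hC hw.memLp_grad
  refine ⟨hw1, hG1, ?_⟩
  have hwi := hw.memLp
  have hGi := hw.memLp_grad
  rw [cylMeasure_eq_prod] at hw1 hG1 hwi hGi
  have hwi := hwi.integrable (by norm_num)
  have hGi := hGi.integrable (by norm_num)
  filter_upwards [(hw1.integrable (by norm_num)).prod_right_ae,
    (hG1.integrable (by norm_num)).prod_right_ae, ae_restrict_mem measurableSet_Ioo]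
    with t ht1 ht2 ht
  refine isWeakGradient_of_integrableOn ht1 ht2 fun φ hφ hφc hφs => ?_
  have hκt : Measurable fun s => κ t s := hκ.comp (f := fun s => (t, s)) (by fun_prop)
  obtain ⟨C1, hC1⟩ := exists_bound_gradient hφ hφc
  obtain ⟨C2, hC2⟩ := hφc.exists_bound_of_continuous hφ.continuous
  have i1 : Integrable (Function.uncurry fun (s : ℝ) (x : Space N) =>
      κ t s • (w (s, x) • gradient φ x))
      ((volume.restrict (Ioo 0 T)).prod (volume.restrict Ω)) := by
    refine Integrable.bdd_smul (φ := fun z : ℝ × Space N => κ t z.1)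
      (Integrable.smul_bdd (f := fun z : ℝ × Space N => gradient φ z.2) hwi C1 ?_ ?_) C ?_ ?_
    · exact (continuous_gradient hφ).aestronglyMeasurable.comp_snd
    · exact Filter.Eventually.of_forall fun z => hC1 z.2
    · exact hκt.aestronglyMeasurable.comp_fst
    · exact Filter.Eventually.of_forall fun z => hC t ht z.1
  have i2 : Integrable (Function.uncurry fun (s : ℝ) (x : Space N) =>
      κ t s • (φ x • G (s, x)))
      ((volume.restrict (Ioo 0 T)).prod (volume.restrict Ω)) := by
    refine Integrable.bdd_smul (φ := fun z : ℝ × Space N => κ t z.1)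
      (Integrable.bdd_smul (φ := fun z : ℝ × Space N => φ z.2) hGi C2 ?_ ?_) C ?_ ?_
    · exact hφ.continuous.aestronglyMeasurable.comp_snd
    · exact Filter.Eventually.of_forall fun z => hC2 z.2
    · exact hκt.aestronglyMeasurable.comp_fst
    · exact Filter.Eventually.of_forall fun z => hC t ht z.1
  calc ∫ x in Ω, SubdiffusionReaction.kernelOp T κ w (t, x) • gradient φ x
      = ∫ x in Ω, ∫ s in Ioo 0 T, κ t s • (w (s, x) • gradient φ x) := by
        refine integral_congr_ae (Filter.Eventually.of_forall fun x => ?_)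
        simp only [SubdiffusionReaction.kernelOp]
        rw [← integral_smul_const]
        simp only [smul_assoc]
    _ = ∫ s in Ioo 0 T, κ t s • ∫ x in Ω, w (s, x) • gradient φ x := by
        rw [← integral_integral_swap i1]
        simp only [integral_smul]
    _ = ∫ s in Ioo 0 T, -(κ t s • ∫ x in Ω, φ x • G (s, x)) := by
        refine integral_congr_ae ?_
        filter_upwards [hw.weakGradient] with s hs
        rw [hs.integral_eq φ hφ hφc hφs, smul_neg]
    _ = -∫ x in Ω, ∫ s in Ioo 0 T, κ t s • (φ x • G (s, x)) := by
        rw [integral_neg, ← integral_integral_swap i2]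
        simp only [integral_smul]
    _ = _ := by
        congr 1
        refine integral_congr_ae (Filter.Eventually.of_forall fun x => ?_)
        simp only [SubdiffusionReaction.kernelOp]
        rw [← integral_smul]
        simp only [smul_comm (φ x)]

theorem IsL2H1.sum_smul (hΩ : Bornology.IsBounded Ω) {ι : Type*} (S : Finset ι) (b : ι → ℝ)
    {w : ι → ℝ × Space N → ℝ} {G : ι → ℝ × Space N → Space N}
    (hw : ∀ i ∈ S, IsL2H1 T Ω (w i) (G i)) :
    IsL2H1 T Ω (fun z => ∑ i ∈ S, b i * w i z) (fun z => ∑ i ∈ S, b i • G i z) := by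
  have := isFiniteMeasure_restrict_of_isBounded hΩ
  refine ⟨memLp_finsetSum S fun i hi => (hw i hi).memLp.const_mul (b i),
    memLp_finsetSum S fun i hi => (hw i hi).memLp_grad.const_smul (b i), ?_⟩
  have h1 : ∀ᵐ t ∂(volume.restrict (Ioo 0 T)), ∀ i ∈ S,
      IsWeakGradient Ω (fun x => w i (t, x)) (fun x => G i (t, x)) ∧
      IntegrableOn (fun x => w i (t, x)) Ω ∧ IntegrableOn (fun x => G i (t, x)) Ω := by
    rw [Filter.eventually_all_finset]
    intro i hi
    have hwi := (hw i hi).memLp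
    have hGi := (hw i hi).memLp_grad
    rw [cylMeasure_eq_prod] at hwi hGi
    filter_upwards [(hw i hi).weakGradient, (hwi.integrable (by norm_num)).prod_right_ae,
      (hGi.integrable (by norm_num)).prod_right_ae] with t h1 h2 h3
    exact ⟨h1, h2, h3⟩
  filter_upwards [h1] with t ht
  refine isWeakGradient_of_integrableOn
    (integrable_finsetSum S fun i hi => (ht i hi).2.1.const_mul (b i))
    (integrable_finsetSum S fun i hi => (ht i hi).2.2.smul (b i)) fun φ hφ hφc hφs => ?_
  obtain ⟨C1, hC1⟩ := exists_bound_gradient hφ hφc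
  obtain ⟨C2, hC2⟩ := hφc.exists_bound_of_continuous hφ.continuous
  have i1 : ∀ i ∈ S, IntegrableOn (fun x => b i • (w i (t, x) • gradient φ x)) Ω := fun i hi =>
    (Integrable.smul_bdd (ht i hi).2.1 C1 (continuous_gradient hφ).aestronglyMeasurable
      (Filter.Eventually.of_forall hC1)).smul (b i)
  have i2 : ∀ i ∈ S, IntegrableOn (fun x => b i • (φ x • G i (t, x))) Ω := fun i hi =>
    (Integrable.bdd_smul (ht i hi).2.2 C2 hφ.continuous.aestronglyMeasurable
      (Filter.Eventually.of_forall hC2)).smul (b i)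
  have e1 : ∀ x, (∑ i ∈ S, b i * w i (t, x)) • gradient φ x =
      ∑ i ∈ S, b i • (w i (t, x) • gradient φ x) := fun x => by
    rw [Finset.sum_smul]
    exact Finset.sum_congr rfl fun i _ => mul_smul _ _ _
  have e2 : ∀ x, φ x • ∑ i ∈ S, b i • G i (t, x) = ∑ i ∈ S, b i • (φ x • G i (t, x)) :=
    fun x => by
      rw [Finset.smul_sum]
      exact Finset.sum_congr rfl fun i _ => smul_comm _ _ _
  simp only [e1, e2]
  rw [integral_finsetSum S i1, integral_finsetSum S i2, ← Finset.sum_neg_distrib]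
  refine Finset.sum_congr rfl fun i hi => ?_
  rw [integral_smul, integral_smul, (ht i hi).1.integral_eq φ hφ hφc hφs, smul_neg]

/-- For `w ∈ L_2((0,T); H^1)` the function `η = l ⋆ S* S w`, with `S` a Steklov average in time, is
an admissible test function. -/
theorem isTestFunction_testKernel (hΩ : Bornology.IsBounded Ω) (hT : 0 < T) {h : ℝ} (hh : 0 < h)
    {l : ℝ → ℝ} (hlm : Measurable l) (hl : Integrable l) {w : ℝ × Space N → ℝ}
    {G : ℝ × Space N → Space N} (hw : IsL2H1 T Ω w G) :
    IsTestFunction T Ω (kernelOp T (testKernel T h l) w)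
      (fun z => -kernelOp T (testDerivKernel T h l) w z) (kernelOp T (testKernel T h l) G) := by
  refine ⟨hw.kernelOp hΩ (measurable_testKernel hlm)
      fun t ht s => abs_testKernel_le hT hh hl ht.1 s,
    (memLp_kernelOp hΩ (measurable_testDerivKernel hlm)
      (fun t _ s => abs_testDerivKernel_le hh hl t s) hw.memLp).neg, ?_⟩
  filter_upwards [ae_cyl_of_ae_space (MemLp.ae_section_integrableOn hΩ hw.memLp)] with z hz
  simp only [kernelOp, smul_eq_mul, integral_neg, neg_neg]
  exact setIntegral_testKernel_mul hh hlm hl hz z.1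

end

/-! ### Steklov averages approximate the identity -/

open Filter Topology

variable {N : ℕ}

/-- Translation of the time variable by `a`. -/
def timeShift (a : ℝ) (z : ℝ × Space N) : ℝ × Space N := (z.1 - a, z.2)

theorem measurePreserving_timeShift (a : ℝ) :
    MeasurePreserving (timeShift a : ℝ × Space N → ℝ × Space N) volume volume := by
  rw [Measure.volume_eq_prod]
  exact (measurePreserving_sub_right volume a).prod (MeasurePreserving.id _)

theorem continuous_timeShift : Continuous fun p : ℝ × (ℝ × Space N) => timeShift p.1 p.2 := by
  unfold timeShift
  fun_prop

/-- Translations in time act continuously on `L_2`. -/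
theorem continuous_setIntegral_timeShift_mul {f v : ℝ × Space N → ℝ} (hf : MemLp f 2 volume)
    (hv : MemLp v 2 volume) (A : Set (ℝ × Space N)) :
    Continuous fun p : ℝ × ℝ => ∫ z in A, f (timeShift p.1 z) * v (timeShift p.2 z) := by
  let g : C(ℝ, C(ℝ × Space N, ℝ × Space N)) := (ContinuousMap.mk _ continuous_timeShift).curry
  have key : ∀ {w : ℝ × Space N → ℝ} (hw : MemLp w 2 volume),
      Continuous fun a : ℝ => (hw.comp_measurePreserving (measurePreserving_timeShift a)).toLp _ :=
    fun {w} hw => (continuous_const (y := hw.toLp w)).compMeasurePreservingLp g.continuous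
      measurePreserving_timeShift (by norm_num)
  have hF := (LpToLpRestrictCLM (ℝ × Space N) ℝ ℝ volume 2 A).continuous.comp (key hf)
  have hV := (LpToLpRestrictCLM (ℝ × Space N) ℝ ℝ volume 2 A).continuous.comp (key hv)
  have hc := (hV.comp continuous_snd).inner (𝕜 := ℝ) (hF.comp continuous_fst)
  refine hc.congr fun p => ?_
  rw [L2.inner_def]
  refine integral_congr_ae ?_
  filter_upwards [LpToLpRestrictCLM_coeFn ℝ A
      ((hf.comp_measurePreserving (measurePreserving_timeShift p.1)).toLp _),
    LpToLpRestrictCLM_coeFn ℝ A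
      ((hv.comp_measurePreserving (measurePreserving_timeShift p.2)).toLp _),
    ae_restrict_of_ae (hf.comp_measurePreserving (measurePreserving_timeShift p.1)).coeFn_toLp,
    ae_restrict_of_ae (hv.comp_measurePreserving (measurePreserving_timeShift p.2)).coeFn_toLp]
    with z h1 h2 h3 h4
  simp only [Function.comp_apply] at *
  rw [h1, h2, h3, h4]
  simp

theorem integrable_timeShift_mul {f v : ℝ × Space N → ℝ} (hf : MemLp f 2 volume)
    (hv : MemLp v 2 volume) (A : Set (ℝ × Space N)) (μ : Measure (ℝ × ℝ)) [IsFiniteMeasure μ] :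
    Integrable (fun q : (ℝ × Space N) × (ℝ × ℝ) =>
      f (timeShift q.2.1 q.1) * v (timeShift q.2.2 q.1)) ((volume.restrict A).prod μ) := by
  have hm : ∀ {w : ℝ × Space N → ℝ} (_ : MemLp w 2 volume) (π : ℝ × ℝ → ℝ) (_ : Measurable π),
      AEStronglyMeasurable (fun q : (ℝ × Space N) × (ℝ × ℝ) => w (timeShift (π q.2) q.1))
        (volume.prod μ) := fun {w} hw π hπ => by
    refine hw.1.comp_quasiMeasurePreserving (QuasiMeasurePreserving.prod_of_left ?_
      (Eventually.of_forall fun p => (measurePreserving_timeShift (π p)).quasiMeasurePreserving))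
    exact continuous_timeShift.measurable.comp
      (f := fun q : (ℝ × Space N) × (ℝ × ℝ) => (π q.2, q.1)) (by fun_prop)
  have hm2 := ((hm hf Prod.fst measurable_fst).mul (hm hv Prod.snd measurable_snd)).mono_measure
    (Measure.prod_mono (Measure.restrict_le_self (s := A)) le_rfl)
  have hi : ∀ p : ℝ × ℝ, Integrable fun z => f (timeShift p.1 z) * v (timeShift p.2 z) := fun p =>
    (hf.comp_measurePreserving (measurePreserving_timeShift p.1)).integrable_mul
      (hv.comp_measurePreserving (measurePreserving_timeShift p.2))
  refine (integrable_prod_iff' hm2).2 ⟨Eventually.of_forall fun p => (hi p).integrableOn, ?_⟩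
  refine Integrable.mono' (integrable_const ((∫ z, f z ^ 2) / 2 + (∫ z, v z ^ 2) / 2))
    hm2.norm.prod_swap.integral_prod_right' (Eventually.of_forall fun p => ?_)
  rw [Real.norm_of_nonneg (integral_nonneg fun _ => norm_nonneg _)]
  have hsq : ∀ {w : ℝ × Space N → ℝ} (_ : MemLp w 2 volume) (a : ℝ),
      Integrable (fun z => w (timeShift a z) ^ 2) ∧
        ∫ z, w (timeShift a z) ^ 2 = ∫ z, w z ^ 2 := fun {w} hw a => by
    have h2 := (memLp_two_iff_integrable_sq hw.1).1 hw
    have hs := measurePreserving_timeShift (N := N) a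
    have hmap : AEStronglyMeasurable (fun z => w z ^ 2) (Measure.map (timeShift a) volume) := by
      rw [hs.map_eq]
      exact h2.1
    refine ⟨hs.integrable_comp_of_integrable h2, ?_⟩
    have := integral_map hs.measurable.aemeasurable hmap
    rw [hs.map_eq] at this
    exact this.symm
  obtain ⟨f1, f2⟩ := hsq hf p.1
  obtain ⟨v1, v2⟩ := hsq hv p.2
  calc ∫ z in A, ‖f (timeShift p.1 z) * v (timeShift p.2 z)‖
      ≤ ∫ z, ‖f (timeShift p.1 z) * v (timeShift p.2 z)‖ :=
        setIntegral_le_integral (hi p).norm (Eventually.of_forall fun _ => norm_nonneg _)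
    _ ≤ ∫ z, (f (timeShift p.1 z) ^ 2 / 2 + v (timeShift p.2 z) ^ 2 / 2) := by
        refine integral_mono (hi p).norm ((f1.div_const 2).add (v1.div_const 2)) fun z => ?_
        simp only [Real.norm_eq_abs, abs_mul]
        nlinarith [sq_nonneg (|f (timeShift p.1 z)| - |v (timeShift p.2 z)|),
          sq_abs (f (timeShift p.1 z)), sq_abs (v (timeShift p.2 z))]
    _ = _ := by
        rw [integral_add (f1.div_const 2) (v1.div_const 2), integral_div, integral_div, f2, v2]

/-- Averages over the squares `(0,h]²` of a function continuous at the origin. -/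
theorem tendsto_average_square {R : ℝ × ℝ → ℝ} (hR : Continuous R) :
    Tendsto (fun h : ℝ => h⁻¹ * h⁻¹ * ∫ p in Ioc 0 h ×ˢ Ioc 0 h, R p) (𝓝[>] 0) (𝓝 (R 0)) := by
  rw [Metric.tendsto_nhds]
  intro ε hε
  obtain ⟨δ, hδ, hRδ⟩ := Metric.continuous_iff.1 hR 0 (ε / 2) (by positivity)
  filter_upwards [Ioo_mem_nhdsGT hδ] with h hh
  have hvol : volume.real (Ioc 0 h ×ˢ Ioc 0 h) = h * h := by
    rw [Measure.volume_eq_prod, measureReal_prod_prod, Real.volume_real_Ioc_of_le hh.1.le, sub_zero]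
  have hfin : volume (Ioc 0 h ×ˢ Ioc 0 h) ≠ ⊤ := by
    rw [Measure.volume_eq_prod, Measure.prod_prod]
    simp [ENNReal.mul_eq_top]
  have hi : IntegrableOn R (Ioc 0 h ×ˢ Ioc 0 h) :=
    (hR.continuousOn.integrableOn_compact (isCompact_Icc.prod isCompact_Icc)).mono_set
      (prod_mono Ioc_subset_Icc_self Ioc_subset_Icc_self)
  have h0 := hh.1.ne'
  have hle : ‖∫ p in Ioc 0 h ×ˢ Ioc 0 h, (R p - R 0)‖ ≤ ε / 2 * (h * h) := by
    rw [← hvol]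
    refine norm_setIntegral_le_of_norm_le_const hfin.lt_top fun p hp => ?_
    rw [← dist_eq_norm]
    refine (hRδ p ?_).le
    rw [Prod.dist_eq, max_lt_iff]
    simp only [Prod.fst_zero, Prod.snd_zero, Real.dist_eq, sub_zero]
    rw [abs_of_pos hp.1.1, abs_of_pos hp.2.1]
    exact ⟨hp.1.2.trans_lt hh.2, hp.2.2.trans_lt hh.2⟩
  have e : h⁻¹ * h⁻¹ * (∫ p in Ioc 0 h ×ˢ Ioc 0 h, R p) - R 0 =
      h⁻¹ * h⁻¹ * ∫ p in Ioc 0 h ×ˢ Ioc 0 h, (R p - R 0) := by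
    rw [integral_sub hi (integrableOn_const hfin), setIntegral_const, hvol, smul_eq_mul]
    field_simp
  rw [Real.dist_eq, e, abs_mul, abs_of_pos (by have := hh.1; positivity)]
  calc h⁻¹ * h⁻¹ * |∫ p in Ioc 0 h ×ˢ Ioc 0 h, (R p - R 0)|
      ≤ h⁻¹ * h⁻¹ * (ε / 2 * (h * h)) :=
        mul_le_mul_of_nonneg_left hle (by have := hh.1; positivity)
    _ = ε / 2 := by field_simp
    _ < ε := by linarith

theorem kernelOp_steklov_eq {T : ℝ} {Ω : Set (Space N)} (h : ℝ) (f : ℝ × Space N → ℝ)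
    {z : ℝ × Space N} (hz : z ∈ cylinder T Ω) :
    kernelOp T (fun t s => steklovKernel h (t - s)) f z =
      h⁻¹ * ∫ a in Ioc 0 h, (cylinder T Ω).indicator f (timeShift a z) := by
  simp only [kernelOp, smul_eq_mul]
  rw [setIntegral_kernel_eq_lineConv, lineConv_comm, lineConv, ← integral_const_mul,
    ← integral_indicator measurableSet_Ioc]
  refine integral_congr_ae (Eventually.of_forall fun a => ?_)
  simp only [steklovKernel, indicator, timeShift, cylinder, mem_prod, hz.2, and_true]
  split_ifs <;> ring

/-- `∫ S_h f S_h v → ∫ f v` for the Steklov averages `S_h`: the left side is the average over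
`(0,h]²` of the correlation of `f` and `v` under time shifts. -/
theorem tendsto_integral_steklov_mul {T : ℝ} {Ω : Set (Space N)} (hΩ : MeasurableSet Ω)
    {f v : ℝ × Space N → ℝ} (hf : MemLp f 2 (cylMeasure T Ω)) (hv : MemLp v 2 (cylMeasure T Ω)) :
    Tendsto (fun h : ℝ => ∫ z, kernelOp T (fun t s => steklovKernel h (t - s)) f z *
        kernelOp T (fun t s => steklovKernel h (t - s)) v z ∂(cylMeasure T Ω))
      (𝓝[>] 0) (𝓝 (∫ z, f z * v z ∂(cylMeasure T Ω))) := by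
  have hcyl : MeasurableSet (cylinder T Ω) := measurableSet_Ioo.prod hΩ
  have hf' := (memLp_indicator_iff_restrict hcyl).2 hf
  have hv' := (memLp_indicator_iff_restrict hcyl).2 hv
  have hlim := tendsto_average_square
    (continuous_setIntegral_timeShift_mul hf' hv' (cylinder T Ω))
  have e0 : ∫ z in cylinder T Ω, (cylinder T Ω).indicator f (timeShift (0 : ℝ × ℝ).1 z) *
      (cylinder T Ω).indicator v (timeShift (0 : ℝ × ℝ).2 z) =
      ∫ z, f z * v z ∂(cylMeasure T Ω) := by
    refine setIntegral_congr_fun hcyl fun z hz => ?_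
    simp [timeShift, indicator_of_mem hz]
  rw [e0] at hlim
  refine hlim.congr fun h => ?_
  have hfin : IsFiniteMeasure ((volume : Measure (ℝ × ℝ)).restrict (Ioc 0 h ×ˢ Ioc 0 h)) :=
    ⟨by
      rw [Measure.restrict_apply_univ, Measure.volume_eq_prod, Measure.prod_prod]
      exact ENNReal.mul_lt_top (by simp) (by simp)⟩
  have hint := integrable_timeShift_mul hf' hv' (cylinder T Ω)
    ((volume : Measure (ℝ × ℝ)).restrict (Ioc 0 h ×ˢ Ioc 0 h))
  have hswap := integral_integral_swap (f := fun z (p : ℝ × ℝ) =>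
    (cylinder T Ω).indicator f (timeShift p.1 z) * (cylinder T Ω).indicator v (timeShift p.2 z))
    hint
  rw [← hswap, ← integral_const_mul]
  refine setIntegral_congr_fun hcyl fun z hz => ?_
  rw [kernelOp_steklov_eq h f hz, kernelOp_steklov_eq h v hz, Measure.volume_eq_prod,
    setIntegral_prod_mul (fun a => (cylinder T Ω).indicator f (timeShift a z))
      (fun a => (cylinder T Ω).indicator v (timeShift a z))]
  ring

/-! ### Testing the equation -/

theorem integral_abs_lineConv_le {a b : ℝ → ℝ} (ha : Integrable a) (hb : Integrable b) :
    ∫ t, |lineConv a b t| ≤ (∫ t, |a t|) * ∫ t, |b t| := by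
  have e := integral_convolution (ContinuousLinearMap.mul ℝ ℝ) hb.abs ha.abs
  have hc := lineConv_eq_convolution (fun t => |b t|) (fun t => |a t|)
  rw [← hc] at e
  calc ∫ t, |lineConv a b t| ≤ ∫ t, lineConv (fun t => |b t|) (fun t => |a t|) t := by
        refine integral_mono (integrable_lineConv ha hb).abs (integrable_lineConv hb.abs ha.abs)
          fun t => ?_
        rw [lineConv_comm]
        refine (abs_integral_le_integral_abs).trans_eq ?_
        simp only [abs_mul]
        rfl
    _ = _ := by
        rw [e, ContinuousLinearMap.mul_apply', mul_comm]

variable {T : ℝ} {Ω : Set (Space N)}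

theorem timeConv_eq_lineConv {k : ℝ → ℝ} {v : ℝ × Space N → ℝ} {z : ℝ × Space N}
    (hz : z.1 ∈ Ioo 0 T) : timeConv k v z =
      lineConv ((Ioo 0 T).indicator k) ((Ioo 0 T).indicator fun s => v (s, z.2)) z.1 :=
  causal_setIntegral_eq_lineConv hz k fun s => v (s, z.2)

theorem timeConv_eq_kernelOp {k : ℝ → ℝ} {v : ℝ × Space N → ℝ} {z : ℝ × Space N}
    (hz : z.1 ∈ Ioo 0 T) : timeConv k v z =
      kernelOp T (fun t s => (Ioo 0 T).indicator k (t - s)) v z := by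
  rw [timeConv_eq_lineConv hz]
  exact (setIntegral_kernel_eq_lineConv T _ _ _).symm

theorem kernelOp_steklov_eq_lineConv (h : ℝ) (v : ℝ × Space N → ℝ) (t : ℝ) (x : Space N) :
    kernelOp T (fun t s => steklovKernel h (t - s)) v (t, x) =
      lineConv (steklovKernel h) ((Ioo 0 T).indicator fun s => v (s, x)) t :=
  setIntegral_kernel_eq_lineConv T _ _ _

theorem integrable_testDeriv_mul_timeConv (hΩ : Bornology.IsBounded Ω) {h : ℝ} (hh : 0 < h)
    {k l : ℝ → ℝ} (hkl : IsTruncatedPair T ((Ioo 0 T).indicator k) l) {w v : ℝ × Space N → ℝ}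
    (hw : MemLp w 2 (cylMeasure T Ω)) (hv : MemLp v 2 (cylMeasure T Ω)) :
    Integrable (fun z => kernelOp T (testDerivKernel T h l) w z * timeConv k v z)
      (cylMeasure T Ω) := by
  have hE := memLp_kernelOp hΩ (measurable_testDerivKernel (T := T) (h := h) hkl.measurable_right)
    (fun t _ s => abs_testDerivKernel_le hh hkl.integrable_right t s) hw
  have hVm : AEStronglyMeasurable (timeConv k v) (cylMeasure T Ω) := by
    refine (aestronglyMeasurable_kernelOp
      (κ := fun t s => (Ioo 0 T).indicator k (t - s)) ?_ hv.1).congr ?_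
    · exact hkl.measurable_left.comp (by fun_prop)
    · filter_upwards [ae_cyl_mem] with z hz using (timeConv_eq_kernelOp hz).symm
  have hm := hE.1.mul hVm
  set K := (∫ r, |l r|) * (h⁻¹ * (h⁻¹ + h⁻¹)) with hK
  set A := ∫ r, |(Ioo 0 T).indicator k r| with hA
  have hMw := memLp_timeIntegral_norm hΩ hw
  have hMv := memLp_timeIntegral_norm hΩ hv
  have hsE := MemLp.ae_section_integrableOn hΩ hE
  have hsw := MemLp.ae_section_integrableOn hΩ hw
  have hsv := MemLp.ae_section_integrableOn hΩ hv
  rw [cylMeasure_eq_prod] at hm ⊢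
  have key : ∀ᵐ x ∂(volume.restrict Ω),
      IntegrableOn (fun t => kernelOp T (testDerivKernel T h l) w (t, x) * timeConv k v (t, x))
        (Ioo 0 T) ∧
      ∫ t in Ioo 0 T, ‖kernelOp T (testDerivKernel T h l) w (t, x) * timeConv k v (t, x)‖ ≤
        K * A * ((∫ s in Ioo 0 T, ‖w (s, x)‖) * ∫ s in Ioo 0 T, ‖v (s, x)‖) := by
    filter_upwards [hsE, hsw, hsv] with x hx1 hx2 hx3
    have hvi := hx3.integrable_indicator measurableSet_Ioo
    have hVi := integrable_lineConv hkl.integrable_left hvi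
    have hVe : ∀ t ∈ Ioo 0 T, timeConv k v (t, x) = lineConv ((Ioo 0 T).indicator k)
        ((Ioo 0 T).indicator fun s => v (s, x)) t := fun t ht =>
      timeConv_eq_lineConv (z := (t, x)) ht
    have hVon : IntegrableOn (fun t => timeConv k v (t, x)) (Ioo 0 T) :=
      (integrableOn_congr_fun hVe measurableSet_Ioo).2 hVi.integrableOn
    have hEb : ∀ᵐ t ∂(volume.restrict (Ioo 0 T)),
        ‖kernelOp T (testDerivKernel T h l) w (t, x)‖ ≤ K * ∫ s in Ioo 0 T, ‖w (s, x)‖ := by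
      filter_upwards [ae_restrict_mem measurableSet_Ioo] with t ht
      exact norm_kernelOp_le
        (fun t _ s => abs_testDerivKernel_le hh hkl.integrable_right t s) ht hx2
    have hi := Integrable.bdd_mul hVon hx1.1 hEb
    refine ⟨hi, ?_⟩
    have hK0 : 0 ≤ K * ∫ s in Ioo 0 T, ‖w (s, x)‖ :=
      mul_nonneg (mul_nonneg (integral_nonneg fun _ => abs_nonneg _) (by positivity))
        (integral_nonneg fun _ => norm_nonneg _)
    calc _ ≤ ∫ t in Ioo 0 T, (K * ∫ s in Ioo 0 T, ‖w (s, x)‖) * ‖timeConv k v (t, x)‖ := by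
          refine integral_mono_ae hi.norm (hVon.norm.const_mul _) ?_
          filter_upwards [hEb] with t ht
          rw [norm_mul]
          exact mul_le_mul_of_nonneg_right ht (norm_nonneg _)
      _ = (K * ∫ s in Ioo 0 T, ‖w (s, x)‖) * ∫ t in Ioo 0 T, ‖lineConv ((Ioo 0 T).indicator k)
            ((Ioo 0 T).indicator fun s => v (s, x)) t‖ := by
          rw [integral_const_mul]
          congr 1
          exact setIntegral_congr_fun measurableSet_Ioo fun t ht => by simp only [hVe t ht]
      _ ≤ (K * ∫ s in Ioo 0 T, ‖w (s, x)‖) * (A * ∫ s in Ioo 0 T, ‖v (s, x)‖) := by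
          refine mul_le_mul_of_nonneg_left ?_ hK0
          refine (setIntegral_le_integral hVi.norm
            (Eventually.of_forall fun _ => norm_nonneg _)).trans
            ((integral_abs_lineConv_le hkl.integrable_left hvi).trans_eq ?_)
          rw [hA, ← integral_indicator measurableSet_Ioo]
          simp only [← Real.norm_eq_abs, norm_indicator_eq_indicator_norm]
      _ = _ := by ring
  refine (integrable_prod_iff' hm).2 ⟨key.mono fun x hx => hx.1, ?_⟩
  refine ((hMw.integrable_mul hMv).const_mul (K * A)).mono'
    hm.norm.prod_swap.integral_prod_right' ?_
  filter_upwards [key] with x hx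
  rw [Real.norm_of_nonneg (integral_nonneg fun _ => norm_nonneg _)]
  exact hx.2

theorem memLp_kernelOp_steklov (hΩ : Bornology.IsBounded Ω) {h : ℝ} (hh : 0 < h)
    {f : ℝ × Space N → ℝ} (hf : MemLp f 2 (cylMeasure T Ω)) :
    MemLp (kernelOp T (fun t s => steklovKernel h (t - s)) f) 2 (cylMeasure T Ω) :=
  memLp_kernelOp hΩ ((measurable_steklovKernel h).comp (by fun_prop))
    (fun _ _ _ => abs_steklovKernel_le hh _) hf

/-- The time derivative tested with `η = l ⋆ S* S w`. -/
theorem integral_testDeriv_mul_timeConv (hΩ : Bornology.IsBounded Ω) {h : ℝ} (hh : 0 < h)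
    {k l : ℝ → ℝ} (hkl : IsTruncatedPair T ((Ioo 0 T).indicator k) l) {w v : ℝ × Space N → ℝ}
    (hw : MemLp w 2 (cylMeasure T Ω)) (hv : MemLp v 2 (cylMeasure T Ω)) :
    ∫ z, kernelOp T (testDerivKernel T h l) w z * timeConv k v z ∂(cylMeasure T Ω) =
      ∫ z, kernelOp T (fun t s => steklovKernel h (t - s)) w z *
        kernelOp T (fun t s => steklovKernel h (t - s)) v z ∂(cylMeasure T Ω) := by
  have i1 := integrable_testDeriv_mul_timeConv hΩ hh hkl hw hv
  have i2 := (memLp_kernelOp_steklov hΩ hh hw).integrable_mul (memLp_kernelOp_steklov hΩ hh hv)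
  have hsw := MemLp.ae_section_integrableOn hΩ hw
  have hsv := MemLp.ae_section_integrableOn hΩ hv
  rw [cylMeasure_eq_prod] at *
  rw [integral_prod_symm _ i1]
  refine Eq.trans ?_ (integral_prod_symm _ i2).symm
  refine integral_congr_ae ?_
  filter_upwards [hsw, hsv] with x hx1 hx2
  have := hkl.integral_testDeriv_mul hh hx1 hx2
  simp only [Pi.mul_apply, kernelOp_steklov_eq_lineConv]
  rw [← this]
  refine setIntegral_congr_fun measurableSet_Ioo fun t ht => ?_
  rw [timeConv_eq_lineConv (T := T) (z := (t, x)) ht]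
  rfl

theorem integrable_inner_of_memLp_two {G H : ℝ × Space N → Space N}
    (hG : MemLp G 2 (cylMeasure T Ω)) (hH : MemLp H 2 (cylMeasure T Ω)) :
    Integrable (fun z => inner ℝ (G z) (H z)) (cylMeasure T Ω) :=
  (hG.norm.integrable_mul hH.norm).mono' (hG.1.inner hH.1)
    (Eventually.of_forall fun _ => norm_inner_le_norm _ _)

/-- The diffusion term tested with `η = l ⋆ S* S w` is nonnegative. -/
theorem integral_inner_testKernel_nonneg (hΩ : Bornology.IsBounded Ω) (hT : 0 < T) {h : ℝ}
    (hh : 0 < h) {k l : ℝ → ℝ} (hkl : IsTruncatedPair T k l) {G : ℝ × Space N → Space N}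
    (hG : MemLp G 2 (cylMeasure T Ω)) :
    0 ≤ ∫ z, inner ℝ (G z) (kernelOp T (testKernel T h l) G z) ∂(cylMeasure T Ω) := by
  have hb : ∀ t ∈ Ioo 0 T, ∀ s, |testKernel T h l t s| ≤ _ := fun t ht s =>
    abs_testKernel_le hT hh hkl.integrable_right ht.1 s
  have hκm := measurable_testKernel (T := T) (h := h) hkl.measurable_right
  have i := integrable_inner_of_memLp_two hG (memLp_kernelOp hΩ hκm hb hG)
  have hs := MemLp.ae_section_integrableOn hΩ hG
  rw [cylMeasure_eq_prod] at *
  rw [integral_prod_symm _ i]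
  refine integral_nonneg_of_ae ?_
  filter_upwards [hs] with x hx
  have hxj : ∀ j, IntegrableOn (fun t => G (t, x) j) (Ioo 0 T) := fun j =>
    (EuclideanSpace.proj (𝕜 := ℝ) j).integrable_comp hx
  have hκi : ∀ t ∈ Ioo 0 T, IntegrableOn (fun s => testKernel T h l t s • G (s, x)) (Ioo 0 T) :=
    fun t ht => Integrable.bdd_smul hx _
      (hκm.comp (f := fun s => (t, s)) (by fun_prop)).aestronglyMeasurable
      (Eventually.of_forall fun s => hb t ht s)
  have e : ∀ t ∈ Ioo 0 T, inner ℝ (G (t, x)) (kernelOp T (testKernel T h l) G (t, x)) =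
      ∑ j, G (t, x) j * ∫ s in Ioo 0 T, testKernel T h l t s * G (s, x) j := fun t ht => by
    rw [PiLp.inner_apply]
    refine Finset.sum_congr rfl fun j _ => ?_
    have := (EuclideanSpace.proj (𝕜 := ℝ) j).integral_comp_comm (hκi t ht)
    simp only [PiLp.proj_apply, PiLp.smul_apply, smul_eq_mul] at this
    rw [this, kernelOp]
    simp [mul_comm]
  simp only [Pi.zero_apply]
  rw [setIntegral_congr_fun measurableSet_Ioo e, integral_finsetSum]
  · exact Finset.sum_nonneg fun j _ => hkl.integral_mul_testKernel_nonneg hh (hxj j)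
  · intro j _
    refine Integrable.mul_bdd (hxj j) (AEStronglyMeasurable.integral_prod_right'
      (f := fun p : ℝ × ℝ => testKernel T h l p.1 p.2 * G (p.2, x) j)
      (hκm.aestronglyMeasurable.mul (hxj j).1.comp_snd)) (c := ((∫ r, |l r|) *
        (h⁻¹ * (h⁻¹ + h⁻¹)) * T) * ∫ s in Ioo 0 T, ‖G (s, x) j‖) ?_
    filter_upwards [ae_restrict_mem measurableSet_Ioo] with t ht
    rw [← integral_const_mul]
    refine norm_integral_le_of_norm_le ((hxj j).norm.const_mul _)
      (Eventually.of_forall fun s => ?_)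
    rw [norm_mul]
    exact mul_le_mul_of_nonneg_right (hb t ht s) (norm_nonneg _)

/-- The duality estimate. In the sum of the four equations with weights `1/a_i` the reactions
cancel, and testing with `l ⋆ S_h* S_h w` for `w = ∑ (d_i/a_i) c_i^m` leaves, as `h → 0`, the
inequality `∑ (1/a_i) ∫ w (c_i - c_i^0) ≤ 0`. -/
theorem IsSolution.duality_estimate {k l : ℝ → ℝ} {m νf νb : ℝ} {a : Fin 4 → ℕ} {d : Fin 4 → ℝ}
    {c : Fin 4 → ℝ × Space N → ℝ} {c₀ : Fin 4 → Space N → ℝ} (hT : 0 < T) (hΩo : IsOpen Ω)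
    (hΩ : Bornology.IsBounded Ω) (hkl : IsPCPair k l) (ha : ∀ i, 0 < a i)
    (hc₀ : ∀ i, MemLp (c₀ i) 2 (volume.restrict Ω))
    (hsol : IsSolution T Ω k m νf νb a d c c₀) :
    ∑ i, (a i : ℝ)⁻¹ * ∫ z, (∑ j, (d j / a j) * c j z ^ m) * (c i z - c₀ i z.2)
      ∂(cylMeasure T Ω) ≤ 0 := by
  obtain ⟨l', hl'⟩ := hkl.exists_truncatedPair T
  choose G hG heq using hsol.equation
  set W : ℝ × Space N → ℝ := fun z => ∑ j, (d j / a j) * c j z ^ m with hW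
  have hL : IsL2H1 T Ω W (fun z => ∑ j, (d j / a j) • G j z) :=
    IsL2H1.sum_smul hΩ Finset.univ (fun j => d j / a j) (w := fun j z => c j z ^ m) (G := G)
      fun j _ => hG j
  have hv : ∀ i, MemLp (fun z : ℝ × Space N => c i z - c₀ i z.2) 2 (cylMeasure T Ω) := fun i => by
    have := (hc₀ i).comp_snd (volume.restrict (Ioo 0 T))
    rw [← cylMeasure_eq_prod] at this
    exact (hsol.memLp i).sub this
  have hlim : Tendsto (fun h : ℝ => ∑ i, (a i : ℝ)⁻¹ *
      ∫ z, kernelOp T (fun t s => steklovKernel h (t - s)) W z *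
        kernelOp T (fun t s => steklovKernel h (t - s)) (fun z => c i z - c₀ i z.2) z
        ∂(cylMeasure T Ω)) (𝓝[>] 0)
      (𝓝 (∑ i, (a i : ℝ)⁻¹ * ∫ z, W z * (c i z - c₀ i z.2) ∂(cylMeasure T Ω))) :=
    tendsto_finsetSum _ fun i _ =>
      (tendsto_integral_steklov_mul hΩo.measurableSet hL.memLp (hv i)).const_mul _
  refine le_of_tendsto hlim ?_
  filter_upwards [self_mem_nhdsWithin] with h hh
  have hh : 0 < h := hh
  have htest := isTestFunction_testKernel hΩ hT hh hl'.measurable_right hl'.integrable_right hL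
  set H := kernelOp T (testKernel T h l') (fun z => ∑ j, (d j / a j) • G j z) with hH
  set η := kernelOp T (testKernel T h l') W with hη
  have ha' : ∀ i, (a i : ℝ) ≠ 0 := fun i => by exact_mod_cast (ha i).ne'
  have hB : ∀ i, Integrable (fun z => inner ℝ (G i z) (H z)) (cylMeasure T Ω) := fun i =>
    integrable_inner_of_memLp_two (hG i).memLp_grad htest.l2h1.memLp_grad
  have hi : ∀ i, (∫ z, kernelOp T (fun t s => steklovKernel h (t - s)) W z *
        kernelOp T (fun t s => steklovKernel h (t - s)) (fun z => c i z - c₀ i z.2) z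
        ∂(cylMeasure T Ω)) + d i * ∫ z, inner ℝ (G i z) (H z) ∂(cylMeasure T Ω) =
      reactionSign i * a i *
        ∫ z, reactionRate νf νb a (fun j => c j z) * η z ∂(cylMeasure T Ω) := fun i => by
    have h1 := heq i _ _ _ htest
    simp only [neg_neg, inner_smul_left, conj_trivial, mul_assoc] at h1
    rw [integral_add (integrable_testDeriv_mul_timeConv hΩ hh hl' hL.memLp (hv i))
      ((hB i).const_mul _), integral_const_mul,
      integral_testDeriv_mul_timeConv hΩ hh hl' hL.memLp (hv i), integral_const_mul,
      integral_const_mul] at h1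
    rw [h1, mul_assoc]
  have hpos := integral_inner_testKernel_nonneg hΩ hT hh hl' hL.memLp_grad
  have hsum : ∫ z, inner ℝ (∑ j, (d j / a j) • G j z) (H z) ∂(cylMeasure T Ω) =
      ∑ j, (d j / a j) * ∫ z, inner ℝ (G j z) (H z) ∂(cylMeasure T Ω) := by
    simp only [sum_inner, inner_smul_left, conj_trivial]
    rw [integral_finsetSum _ fun j _ => (hB j).const_mul _]
    simp only [integral_const_mul]
  rw [← hH, hsum] at hpos
  set ρ := ∫ z, reactionRate νf νb a (fun j => c j z) * η z ∂(cylMeasure T Ω) with hρ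
  have hsign : ∑ i, reactionSign i = 0 := by simp [reactionSign, Fin.sum_univ_four]
  have hrew : ∀ i, (a i : ℝ)⁻¹ * (∫ z, kernelOp T (fun t s => steklovKernel h (t - s)) W z *
        kernelOp T (fun t s => steklovKernel h (t - s)) (fun z => c i z - c₀ i z.2) z
        ∂(cylMeasure T Ω)) = reactionSign i * ρ -
      (d i / a i) * ∫ z, inner ℝ (G i z) (H z) ∂(cylMeasure T Ω) := fun i => by
    rw [eq_sub_of_add_eq (hi i)]
    have := ha' i
    field_simp
  rw [Finset.sum_congr rfl fun i _ => hrew i, Finset.sum_sub_distrib, ← Finset.sum_mul, hsign]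
  linarith

/-! ### From the duality estimate to the norm bound -/

/-- A form of Young's inequality for the exponents `(m+1)/m` and `m+1`. -/
theorem rpow_mul_le_add_rpow {m x y ε : ℝ} (hm : 0 ≤ m) (hx : 0 ≤ x) (hy : 0 ≤ y) (hε : 0 < ε) :
    x ^ m * y ≤ ε * x ^ (m + 1) + (ε⁻¹) ^ m * y ^ (m + 1) := by
  have h1 : 0 ≤ (ε⁻¹) ^ m * y ^ (m + 1) := by positivity
  have h2 : 0 ≤ ε * x ^ (m + 1) := by positivity
  have e : ∀ {z : ℝ}, 0 ≤ z → z ^ (m + 1) = z ^ m * z := fun {z} hz => by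
    rw [Real.rpow_add_of_nonneg hz hm zero_le_one, Real.rpow_one]
  rcases le_or_gt y (ε * x) with h | h
  · have : x ^ m * y ≤ x ^ m * (ε * x) := mul_le_mul_of_nonneg_left h (by positivity)
    rw [e hx] at h2 ⊢
    linarith
  · have hxy : x ≤ ε⁻¹ * y := by
      rw [le_inv_mul_iff₀ hε]
      exact h.le
    have : x ^ m * y ≤ (ε⁻¹ * y) ^ m * y :=
      mul_le_mul_of_nonneg_right (Real.rpow_le_rpow hx hxy hm) hy
    rw [Real.mul_rpow (by positivity) hy, mul_assoc, ← e hy] at this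
    linarith

/-- Pointwise coercivity of the duality integrand, up to a multiple of the initial values. -/
theorem exists_coercivity_const {m : ℝ} (hm : 0 ≤ m) {a : Fin 4 → ℕ} (ha : ∀ i, 0 < a i)
    {d : Fin 4 → ℝ} (hd : ∀ i, 0 < d i) :
    ∃ K₁ K₂ : ℝ, 0 ≤ K₁ ∧ 0 ≤ K₂ ∧ ∀ x y : Fin 4 → ℝ, (∀ i, 0 ≤ x i) → (∀ i, 0 ≤ y i) →
      ∑ i, x i ^ (m + 1) ≤
        K₁ * (∑ i, (a i : ℝ)⁻¹ * ((∑ j, (d j / a j) * x j ^ m) * (x i - y i))) +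
          K₂ * ∑ i, y i ^ (m + 1) := by
  have ha' : ∀ i, 0 < (a i : ℝ) := fun i => by exact_mod_cast ha i
  set D : ℝ := ∑ i, ∑ j, (a i : ℝ)⁻¹ * (d j / a j) with hD
  have hDij : ∀ i j, 0 < (a i : ℝ)⁻¹ * (d j / a j) := fun i j =>
    mul_pos (inv_pos.2 (ha' i)) (div_pos (hd j) (ha' j))
  have hDle : ∀ i j, (a i : ℝ)⁻¹ * (d j / a j) ≤ D := fun i j =>
    (Finset.single_le_sum (f := fun j => (a i : ℝ)⁻¹ * (d j / a j)) (fun j _ => (hDij i j).le)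
      (Finset.mem_univ j)).trans (Finset.single_le_sum
        (f := fun i => ∑ j, (a i : ℝ)⁻¹ * (d j / a j))
        (fun i _ => Finset.sum_nonneg fun j _ => (hDij i j).le) (Finset.mem_univ i))
  have hD0 : 0 < D := (hDij 0 0).trans_le (hDle 0 0)
  obtain ⟨i₀, -, hi₀⟩ := Finset.exists_min_image (Finset.univ : Finset (Fin 4))
    (fun i => (a i : ℝ)⁻¹ * (d i / a i)) Finset.univ_nonempty
  set δ := (a i₀ : ℝ)⁻¹ * (d i₀ / a i₀) with hδ
  have hδ0 : 0 < δ := hDij i₀ i₀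
  -- With this choice the sixteen cross terms absorb at most half of the diagonal.
  set ε := δ / (8 * D) with hε
  have hε0 : 0 < ε := by positivity
  set M := (ε⁻¹) ^ m with hM
  have hM0 : 0 < M := by positivity
  refine ⟨2 / δ, 8 * D * M / δ, by positivity, by positivity, fun x y hx hy => ?_⟩
  set X := ∑ i, x i ^ (m + 1) with hX
  set Y := ∑ i, y i ^ (m + 1) with hY
  have hsplit : ∑ i, (a i : ℝ)⁻¹ * ((∑ j, (d j / a j) * x j ^ m) * (x i - y i)) =
      (∑ i, ∑ j, (a i : ℝ)⁻¹ * (d j / a j) * (x j ^ m * x i)) -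
        ∑ i, ∑ j, (a i : ℝ)⁻¹ * (d j / a j) * (x j ^ m * y i) := by
    rw [← Finset.sum_sub_distrib]
    refine Finset.sum_congr rfl fun i _ => ?_
    rw [← Finset.sum_sub_distrib, Finset.sum_mul, Finset.mul_sum]
    exact Finset.sum_congr rfl fun j _ => by ring
  have hP1 : δ * X ≤ ∑ i, ∑ j, (a i : ℝ)⁻¹ * (d j / a j) * (x j ^ m * x i) := by
    rw [hX, Finset.mul_sum]
    refine Finset.sum_le_sum fun i _ => ?_
    refine le_trans ?_ (Finset.single_le_sum
      (f := fun j => (a i : ℝ)⁻¹ * (d j / a j) * (x j ^ m * x i)) (fun j _ => mul_nonneg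
        (hDij i j).le (mul_nonneg (Real.rpow_nonneg (hx j) _) (hx i))) (Finset.mem_univ i))
    rw [Real.rpow_add_of_nonneg (hx i) hm zero_le_one, Real.rpow_one]
    exact mul_le_mul_of_nonneg_right (hi₀ i (Finset.mem_univ i))
      (mul_nonneg (Real.rpow_nonneg (hx i) _) (hx i))
  have hP2 : ∑ i, ∑ j, (a i : ℝ)⁻¹ * (d j / a j) * (x j ^ m * y i) ≤
      4 * D * (ε * X + M * Y) := by
    calc ∑ i, ∑ j, (a i : ℝ)⁻¹ * (d j / a j) * (x j ^ m * y i)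
        ≤ ∑ i, ∑ j, D * (ε * x j ^ (m + 1) + M * y i ^ (m + 1)) :=
          Finset.sum_le_sum fun i _ => Finset.sum_le_sum fun j _ =>
            mul_le_mul (hDle i j) (rpow_mul_le_add_rpow hm (hx j) (hy i) hε0)
              (mul_nonneg (Real.rpow_nonneg (hx j) _) (hy i)) hD0.le
      _ = 4 * D * (ε * X + M * Y) := by
          simp only [hX, hY, Fin.sum_univ_four]
          ring
  rw [hsplit]
  have hDε : D * ε = δ / 8 := by
    rw [hε]
    field_simp
  have hmain : δ / 2 * X ≤ (∑ i, ∑ j, (a i : ℝ)⁻¹ * (d j / a j) * (x j ^ m * x i)) -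
      (∑ i, ∑ j, (a i : ℝ)⁻¹ * (d j / a j) * (x j ^ m * y i)) + 4 * D * M * Y := by
    have : 4 * D * (ε * X + M * Y) = 4 * (D * ε) * X + 4 * D * M * Y := by ring
    rw [hDε] at this
    linarith
  have h2 := mul_le_mul_of_nonneg_left hmain (show 0 ≤ 2 / δ by positivity)
  have e1 : 2 / δ * (δ / 2 * X) = X := by field_simp
  rw [e1] at h2
  refine h2.trans_eq ?_
  field_simp
  ring

theorem eLpNorm_eq_ofReal_of_nonneg {α : Type*} [MeasurableSpace α] {μ : Measure α} {p : ℝ}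
    (hp : 0 < p) {f : α → ℝ} (hf : AEStronglyMeasurable f μ) (hf0 : ∀ᵐ z ∂μ, 0 ≤ f z)
    (hfi : Integrable (fun z => f z ^ p) μ) :
    eLpNorm f (ENNReal.ofReal p) μ = ENNReal.ofReal ((∫ z, f z ^ p ∂μ) ^ p⁻¹) := by
  have hp0 : ENNReal.ofReal p ≠ 0 := by simpa using hp
  have e : (fun z => ‖f z‖ ^ (ENNReal.ofReal p).toReal) =ᵐ[μ] fun z => f z ^ p := by
    filter_upwards [hf0] with z hz
    rw [Real.norm_of_nonneg hz, ENNReal.toReal_ofReal hp.le]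
  have hmem : MemLp f (ENNReal.ofReal p) μ :=
    (integrable_norm_rpow_iff hf hp0 ENNReal.ofReal_ne_top).1 (hfi.congr e.symm)
  rw [hmem.eLpNorm_eq_integral_rpow_norm hp0 ENNReal.ofReal_ne_top, integral_congr_ae e,
    ENNReal.toReal_ofReal hp.le]

theorem sum_rpow_inv_le {p C : ℝ} (hp : 0 < p) (hC : 0 ≤ C) {x y : Fin 4 → ℝ}
    (hx : ∀ i, 0 ≤ x i) (hy : ∀ i, 0 ≤ y i) (h : ∑ i, x i ≤ C * ∑ i, y i) :
    ∑ i, x i ^ p⁻¹ ≤ 4 * (4 * C) ^ p⁻¹ * ∑ i, y i ^ p⁻¹ := by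
  set Y := ∑ i, y i ^ p⁻¹ with hY
  have hY0 : 0 ≤ Y := Finset.sum_nonneg fun i _ => Real.rpow_nonneg (hy i) _
  have hyY : ∀ i, y i ≤ Y ^ p := fun i => by
    rw [← Real.rpow_inv_le_iff_of_pos (hy i) hY0 hp]
    exact Finset.single_le_sum (f := fun i => y i ^ p⁻¹)
      (fun i _ => Real.rpow_nonneg (hy i) _) (Finset.mem_univ i)
  have hxY : ∀ i, x i ^ p⁻¹ ≤ (4 * C) ^ p⁻¹ * Y := fun i => by
    have h1 : x i ≤ 4 * C * Y ^ p := by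
      refine (Finset.single_le_sum (f := x) (fun i _ => hx i) (Finset.mem_univ i)).trans
        (h.trans ?_)
      have : ∑ i, y i ≤ ∑ _i : Fin 4, Y ^ p := Finset.sum_le_sum fun i _ => hyY i
      rw [Finset.sum_const, Finset.card_univ, Fintype.card_fin, nsmul_eq_mul] at this
      push_cast at this
      nlinarith [mul_le_mul_of_nonneg_left this hC]
    refine (Real.rpow_le_rpow (hx i) h1 (by positivity)).trans_eq ?_
    rw [Real.mul_rpow (by positivity) (by positivity), Real.rpow_rpow_inv hY0 hp.ne']
  calc ∑ i, x i ^ p⁻¹ ≤ ∑ _i : Fin 4, (4 * C) ^ p⁻¹ * Y := Finset.sum_le_sum fun i _ => hxY i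
    _ = _ := by
        rw [Finset.sum_const, Finset.card_univ, Fintype.card_fin, nsmul_eq_mul]
        push_cast
        ring

end SubdiffusionReaction

end

theorem mainTheorem7 (m T L : ℝ) (hm : 1 ≤ m) (hT : 0 < T) (a : Fin 4 → ℕ) (ha : ∀ i, 0 < a i)
    (d : Fin 4 → ℝ) (hd : ∀ i, 0 < d i) :
    ∃ C : ℝ≥0, ∀ (N : ℕ) (Ω : Set (SubdiffusionReaction.Space N)),
      IsOpen Ω → Bornology.IsBounded Ω →
      ∀ (k l : ℝ → ℝ), SubdiffusionReaction.IsPCPair k l → (∫ t in Ioo 0 T, |l t|) = L →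
      ∀ (νf νb : ℝ) (c₀ : Fin 4 → SubdiffusionReaction.Space N → ℝ),
      (∀ i, MemLp (c₀ i) ∞ (volume.restrict Ω)) →
      (∀ i, ∀ᵐ x ∂(volume.restrict Ω), 0 ≤ c₀ i x) →
      ∀ c : Fin 4 → ℝ × SubdiffusionReaction.Space N → ℝ,
      (∀ i, ∀ᵐ z ∂(SubdiffusionReaction.cylMeasure T Ω), 0 ≤ c i z) →
      SubdiffusionReaction.IsSolution T Ω k m νf νb a d c c₀ →
      ∑ i, eLpNorm (c i) (ENNReal.ofReal (m + 1)) (SubdiffusionReaction.cylMeasure T Ω) ≤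
        C * ∑ i, eLpNorm (c₀ i) (ENNReal.ofReal (m + 1)) (volume.restrict Ω) := by
  have hm0 : 0 ≤ m := by linarith
  have hp : 0 < m + 1 := by linarith
  obtain ⟨K₁, K₂, hK₁, hK₂, hcoer⟩ := SubdiffusionReaction.exists_coercivity_const hm0 ha hd
  have hC0 : 0 ≤ 4 * (4 * (K₂ * T)) ^ (m + 1)⁻¹ := by positivity
  refine ⟨(4 * (4 * (K₂ * T)) ^ (m + 1)⁻¹).toNNReal, ?_⟩
  intro N Ω hΩo hΩ k l hkl _ νf νb c₀ hc₀ hc₀n c hcn hsol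
  have := SubdiffusionReaction.isFiniteMeasure_restrict_of_isBounded hΩ
  have hdual := hsol.duality_estimate hT hΩo hΩ hkl ha
    fun i => (hc₀ i).mono_exponent le_top
  set μ := SubdiffusionReaction.cylMeasure T Ω with hμ
  have hμp : μ = (volume.restrict (Ioo 0 T)).prod (volume.restrict Ω) :=
    SubdiffusionReaction.cylMeasure_eq_prod T Ω
  have hcm : ∀ i, MemLp (fun z => c i z ^ m) 2 μ := fun i => by
    obtain ⟨G, hG, -⟩ := hsol.equation i
    exact hG.memLp
  have hcp : ∀ i, Integrable (fun z => c i z ^ (m + 1)) μ := fun i => by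
    refine ((hcm i).integrable_mul (hsol.memLp i)).congr ?_
    filter_upwards [hcn i] with z hz
    rw [Pi.mul_apply, Real.rpow_add_of_nonneg hz hm0 zero_le_one, Real.rpow_one]
  have hyp : ∀ i, Integrable (fun x => c₀ i x ^ (m + 1)) (volume.restrict Ω) := fun i => by
    have h1 : MemLp (c₀ i) (ENNReal.ofReal (m + 1)) (volume.restrict Ω) :=
      (hc₀ i).mono_exponent le_top
    have h2 := (integrable_norm_rpow_iff h1.1 (by simpa using hp) ENNReal.ofReal_ne_top).2 h1
    refine h2.congr ?_
    filter_upwards [hc₀n i] with x hx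
    rw [Real.norm_of_nonneg hx, ENNReal.toReal_ofReal hp.le]
  have hyp' : ∀ i, Integrable (fun z : ℝ × SubdiffusionReaction.Space N => c₀ i z.2 ^ (m + 1)) μ :=
    fun i => by
      rw [hμp]
      exact (hyp i).comp_snd _
  have hyint : ∀ i, ∫ z, c₀ i z.2 ^ (m + 1) ∂μ = T * ∫ x in Ω, c₀ i x ^ (m + 1) := fun i => by
    rw [hμp, integral_fun_snd (fun x => c₀ i x ^ (m + 1)), measureReal_restrict_apply_univ,
      Real.volume_real_Ioo_of_le hT.le, sub_zero, smul_eq_mul]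
  have hW : MemLp (fun z => ∑ j, (d j / a j) * c j z ^ m) 2 μ :=
    memLp_finsetSum _ fun j _ => (hcm j).const_mul _
  have hPi : ∀ i, Integrable (fun z : ℝ × SubdiffusionReaction.Space N =>
      (a i : ℝ)⁻¹ * ((∑ j, (d j / a j) * c j z ^ m) * (c i z - c₀ i z.2))) μ := fun i => by
    have h1 : MemLp (fun z : ℝ × SubdiffusionReaction.Space N => c₀ i z.2) 2 μ := by
      rw [hμp]
      exact ((hc₀ i).mono_exponent le_top).comp_snd _
    exact (hW.integrable_mul ((hsol.memLp i).sub h1)).const_mul _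
  have hmain : ∑ i, ∫ z, c i z ^ (m + 1) ∂μ ≤
      K₂ * T * ∑ i, ∫ x in Ω, c₀ i x ^ (m + 1) := by
    have h1 : ∫ z, ∑ i, c i z ^ (m + 1) ∂μ ≤ ∫ z, (K₁ * (∑ i, (a i : ℝ)⁻¹ *
        ((∑ j, (d j / a j) * c j z ^ m) * (c i z - c₀ i z.2))) +
          K₂ * ∑ i, c₀ i z.2 ^ (m + 1)) ∂μ := by
      refine integral_mono_ae (integrable_finsetSum _ fun i _ => hcp i)
        (((integrable_finsetSum _ fun i _ => hPi i).const_mul _).add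
          ((integrable_finsetSum _ fun i _ => hyp' i).const_mul _)) ?_
      filter_upwards [ae_all_iff.2 hcn, ae_all_iff.2 fun i =>
        SubdiffusionReaction.ae_cyl_of_ae_space (T := T) (hc₀n i)] with z hz1 hz2
      exact hcoer (fun i => c i z) (fun i => c₀ i z.2) hz1 hz2
    rw [integral_finsetSum _ fun i _ => hcp i,
      integral_add ((integrable_finsetSum _ fun i _ => hPi i).const_mul _)
        ((integrable_finsetSum _ fun i _ => hyp' i).const_mul _),
      integral_const_mul, integral_const_mul, integral_finsetSum _ fun i _ => hPi i,
      integral_finsetSum _ fun i _ => hyp' i] at h1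
    simp only [integral_const_mul, hyint, ← Finset.mul_sum] at h1
    have h2 := mul_nonpos_of_nonneg_of_nonpos hK₁ hdual
    linarith
  have hx0 : ∀ i, 0 ≤ ∫ z, c i z ^ (m + 1) ∂μ := fun i =>
    integral_nonneg_of_ae ((hcn i).mono fun z hz => Real.rpow_nonneg hz _)
  have hy0 : ∀ i, 0 ≤ ∫ x in Ω, c₀ i x ^ (m + 1) := fun i =>
    integral_nonneg_of_ae ((hc₀n i).mono fun z hz => Real.rpow_nonneg hz _)
  have hfinal := SubdiffusionReaction.sum_rpow_inv_le hp (mul_nonneg hK₂ hT.le) hx0 hy0 hmain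
  have e1 : ∀ i, eLpNorm (c i) (ENNReal.ofReal (m + 1)) μ =
      ENNReal.ofReal ((∫ z, c i z ^ (m + 1) ∂μ) ^ (m + 1)⁻¹) := fun i =>
    SubdiffusionReaction.eLpNorm_eq_ofReal_of_nonneg hp (hsol.memLp i).1 (hcn i) (hcp i)
  have e2 : ∀ i, eLpNorm (c₀ i) (ENNReal.ofReal (m + 1)) (volume.restrict Ω) =
      ENNReal.ofReal ((∫ x in Ω, c₀ i x ^ (m + 1)) ^ (m + 1)⁻¹) := fun i =>
    SubdiffusionReaction.eLpNorm_eq_ofReal_of_nonneg hp (hc₀ i).1 (hc₀n i) (hyp i)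
  simp only [e1, e2]
  rw [← ENNReal.ofReal_sum_of_nonneg fun i _ => Real.rpow_nonneg (hx0 i) _,
    ← ENNReal.ofReal_sum_of_nonneg fun i _ => Real.rpow_nonneg (hy0 i) _,
    ← ENNReal.ofReal.eq_1, ← ENNReal.ofReal_mul hC0]
  exact ENNReal.ofReal_le_ofReal hfinal
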